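/- **Setting.** LF expressions are kinds $K ::= \mathsf{type} \mid \Pi x{:}A.K$, type families $A,B ::= u \mid \Pi x{:}A.B \mid \lambda x{:}A.B \mid A\,M$ and objects $M,N ::= x \mid \lambda x{:}A.M \mid M\,N$, taken up to renaming of bound variables. $P^\beta$ is the $\beta$-normal form of $P$, if it exists. A *base type* is a type $u\,M_1\cdots M_n$. A *context* is a finite list of declarations $x:A$ and $u:K$. *Canonical LF* derives the assertions "$\Gamma$ ctx", $\Gamma\vdash K$ kind, $\Gamma\vdash A:K$ and $\Gamma\vdash M:A$ by the following rules. * The empty context is well-formed. If $\Gamma$ is a well-formed context, so is $\Gamma,u:K$ when $\Gamma\vdash K$ kind and $u\notin dom(\Gamma)$, and so is $\Gamma,x:A$ when $\Gamma\vdash A:\mathsf{type}$ and $x\notin dom(\Gamma)$. * If $\Gamma$ is well-formed, then $\Gamma\vdash\mathsf{type}$ kind. * If $\Gamma\vdash A:\mathsf{type}$, then: $\Gamma,x{:}A\vdash K$ kind gives $\Gamma\vdash\Pi x{:}A.K$ kind; $\Gamma,x{:}A\vdash B:\mathsf{type}$ gives $\Gamma\vdash\Pi x{:}A.B:\mathsf{type}$;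 $\Gamma,x{:}A\vdash B:K$ gives $\Gamma\vdash\lambda x{:}A.B:\Pi x{:}A.K$; and $\Gamma,x{:}A\vdash M:B$ gives $\Gamma\vdash\lambda x{:}A.M:\Pi x{:}A.B$. * Backchaining: if $\Gamma$ is well-formed, $(y:\Pi x_1{:}B_1\ldots\Pi x_n{:}B_n.A)\in\Gamma$ with $A$ a base type, and $\Gamma\vdash N_k:(B_k[N_1/x_1,\ldots,N_{k-1}/x_{k-1}])^\beta$ for $k=1,\dots,n$, then $\Gamma\vdash y\,N_1\cdots N_n:(A[N_1/x_1,\ldots,N_n/x_n])^\beta$. Likewise, for $(u:\Pi x_1{:}B_1\ldots\Pi x_n{:}B_n.\mathsf{type})\in\Gamma$, the same premises give $\Gamma\vdash u\,N_1\cdots N_n:\mathsf{type}$. *Eta-long forms.* For an object $N$ and a type $B$ define $\eta_B(N)=\lambda x{:}C.\,\eta_D(N\,\eta_C(x))$ if $B=\Pi x{:}C.D$, and $\eta_B(N)=N$ if $B$ is not a product. The $\beta\eta$-long form of $N$ at $B$ is $\eta_B(N)^\beta$. *Rigid occurrences.* For a vector of variables $\vec x$, a set $\delta$ of variables and $x_i$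 in $\vec x$, the judgment $\vec x;\delta;x_i\vdash M$ ("$x_i$ occurs rigidly in $M$") is defined inductively: * $\vec x;\delta;x_i\vdash x_i\,y_1\cdots y_k$ if $y_1,\dots,y_k$ are distinct object variables in $\delta$ (each argument $y_j$ may be written in an $\eta$-expanded form $\eta_C(y_j)$); * $\vec x;\delta;x_i\vdash y\,M_1\cdots M_k$ if $y\notin\vec x$ and $\vec x;\delta;x_i\vdash M_j$ for some $j$; * $\vec x;\delta;x_i\vdash\lambda y{:}A.M$ if $\vec x;\delta,y;x_i\vdash M$. **Theorem.** Let $\vec N=N_1,\dots,N_n$ be LF objects, $\vec x=x_1,\dots,x_n$ distinct object variables, $\vec B=B_1,\dots,B_n$ types, $\Gamma$ and $\Delta$ contexts, $M$ an object and $A$ a type. Assume that the free variables of the $N_j$ are neither declared in $\Delta$ nor among $\vec x$. Put $\Gamma_0=x_1:B_1,\dots,x_n:B_n$ and $\delta=dom(\Delta)$. Suppose that * $\vec x;\delta;x_i\vdash M$; * $\Gamma,\Gamma_0,\Delta\vdash M:A$ is derivable in canonical LF; * the $\beta$-normal forms of $\Delta[\vec N/\vec x]$, $M[\vec N/\vec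 x]$ and $A[\vec N/\vec x]$ exist, and $\Gamma,\Delta[\vec N/\vec x]^\beta\vdash M[\vec N/\vec x]^\beta:A[\vec N/\vec x]^\beta$ is derivable in canonical LF. Then $B_i'=(B_i[N_1/x_1,\ldots,N_{i-1}/x_{i-1}])^\beta$ exists, $N_i$ has a $\beta\eta$-long form $N_i'$ at $B_i'$, and $\Gamma\vdash N_i':B_i'$ is derivable in canonical LF. In particular, if $N_i$ is already in $\beta\eta$-long form at $B_i'$ (that is, $N_i'=N_i$), then $\Gamma\vdash N_i:B_i'$ is derivable in canonical LF. -/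

import Mathlib

/-!  Canonical LF: syntax, beta-normalisation, the typing rules, and rigid occurrences. 

Object variables are de Bruijn indices (the only binders of LF bind object variables); type
variables are never bound inside expressions and are kept as names, drawn from `ℕ`. -/

namespace CanonicalLF

/-- The three syntactic categories of LF. -/
inductive Cat : Type
  | obj
  | fam
  | kind

/-- LF expressions, by category.
Kinds `K ::= type | Πx:A.K`, type families `A ::= u | Πx:A.B | λx:A.B | A M`,
objects `M ::= x | λx:A.M | M N`.  The second argument of every binder lives under one more
object variable, which has index `0` there. -/
inductive Exp : Cat → Type
  | type : Exp Cat.kind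
  | piK (A : Exp Cat.fam) (K : Exp Cat.kind) : Exp Cat.kind
  | tvar (u : ℕ) : Exp Cat.fam
  | piF (A : Exp Cat.fam) (B : Exp Cat.fam) : Exp Cat.fam
  | lamF (A : Exp Cat.fam) (B : Exp Cat.fam) : Exp Cat.fam
  | appF (A : Exp Cat.fam) (M : Exp Cat.obj) : Exp Cat.fam
  | var (x : ℕ) : Exp Cat.obj
  | lamO (A : Exp Cat.fam) (M : Exp Cat.obj) : Exp Cat.obj
  | appO (M : Exp Cat.obj) (N : Exp Cat.obj) : Exp Cat.obj

abbrev Obj : Type := Exp Cat.obj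
abbrev Fam : Type := Exp Cat.fam
abbrev Kind : Type := Exp Cat.kind

/-! ### Renaming and capture-avoiding simultaneous substitution -/

/-- A renaming pushed under one binder. -/
def upRen (r : ℕ → ℕ) : ℕ → ℕ
  | 0 => 0
  | n + 1 => r n + 1

def Exp.rename : {c : Cat} → (ℕ → ℕ) → Exp c → Exp c
  | _, _, .type => .type
  | _, r, .piK A K => .piK (A.rename r) (K.rename (upRen r))
  | _, _, .tvar u => .tvar u
  | _, r, .piF A B => .piF (A.rename r) (B.rename (upRen r))
  | _, r, .lamF A B => .lamF (A.rename r) (B.rename (upRen r))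
  | _, r, .appF A M => .appF (A.rename r) (M.rename r)
  | _, r, .var x => .var (r x)
  | _, r, .lamO A M => .lamO (A.rename r) (M.rename (upRen r))
  | _, r, .appO M N => .appO (M.rename r) (N.rename r)

/-- Weakening by one object variable. -/
def Exp.shift {c : Cat} (e : Exp c) : Exp c := e.rename Nat.succ

/-- A substitution pushed under one binder. -/
def up (s : ℕ → Obj) : ℕ → Obj
  | 0 => .var 0
  | n + 1 => (s n).shift

/-- A substitution pushed under `d` binders. -/
def upN : ℕ → (ℕ → Obj) → (ℕ → Obj)
  | 0, s => s
  | d + 1, s => up (upN d s)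

def Exp.subst : {c : Cat} → (ℕ → Obj) → Exp c → Exp c
  | _, _, .type => .type
  | _, s, .piK A K => .piK (A.subst s) (K.subst (up s))
  | _, _, .tvar u => .tvar u
  | _, s, .piF A B => .piF (A.subst s) (B.subst (up s))
  | _, s, .lamF A B => .lamF (A.subst s) (B.subst (up s))
  | _, s, .appF A M => .appF (A.subst s) (M.subst s)
  | _, s, .var x => s x
  | _, s, .lamO A M => .lamO (A.subst s) (M.subst (up s))
  | _, s, .appO M N => .appO (M.subst s) (N.subst s)

/-- The simultaneous substitution `[N₁/x₁, …, Nₙ/xₙ]`, where `x₁, …, xₙ` are the `n` innermost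
variables in order of declaration (so `xₙ` has index `0`), and the `N`s live outside them. -/
def inst (N : List Obj) : ℕ → Obj :=
  fun x => (N.reverse[x]?).getD (.var (x - N.length))

/-! ### Beta-reduction and normal forms -/

/-- One step of beta-reduction, anywhere in an expression. -/
inductive Step : {c : Cat} → Exp c → Exp c → Prop
  | betaF (A B : Fam) (M : Obj) : Step (.appF (.lamF A B) M) (B.subst (inst [M]))
  | betaO (A : Fam) (M N : Obj) : Step (.appO (.lamO A M) N) (M.subst (inst [N]))
  | piK₁ {A A' : Fam} {K : Kind} : Step A A' → Step (.piK A K) (.piK A' K)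
  | piK₂ {A : Fam} {K K' : Kind} : Step K K' → Step (.piK A K) (.piK A K')
  | piF₁ {A A' B : Fam} : Step A A' → Step (.piF A B) (.piF A' B)
  | piF₂ {A B B' : Fam} : Step B B' → Step (.piF A B) (.piF A B')
  | lamF₁ {A A' B : Fam} : Step A A' → Step (.lamF A B) (.lamF A' B)
  | lamF₂ {A B B' : Fam} : Step B B' → Step (.lamF A B) (.lamF A B')
  | appF₁ {A A' : Fam} {M : Obj} : Step A A' → Step (.appF A M) (.appF A' M)
  | appF₂ {A : Fam} {M M' : Obj} : Step M M' → Step (.appF A M) (.appF A M')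
  | lamO₁ {A A' : Fam} {M : Obj} : Step A A' → Step (.lamO A M) (.lamO A' M)
  | lamO₂ {A : Fam} {M M' : Obj} : Step M M' → Step (.lamO A M) (.lamO A M')
  | appO₁ {M M' N : Obj} : Step M M' → Step (.appO M N) (.appO M' N)
  | appO₂ {M N N' : Obj} : Step N N' → Step (.appO M N) (.appO M N')

/-- `BetaNF e e'`: `e'` is the beta-normal form of `e`. -/
def BetaNF {c : Cat} (e e' : Exp c) : Prop :=
  Relation.ReflTransGen Step e e' ∧ ∀ e'', ¬ Step e' e''

/-! ### Iterated products and applications, base types -/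

/-- `Πx₁:B₁.…Πxₙ:Bₙ.A`; `B_k` lives under `x₁, …, x_{k-1}`. -/
def pisF : List Fam → Fam → Fam
  | [], A => A
  | B :: Bs, A => .piF B (pisF Bs A)

/-- `Πx₁:B₁.…Πxₙ:Bₙ.K`. -/
def pisK : List Fam → Kind → Kind
  | [], K => K
  | B :: Bs, K => .piK B (pisK Bs K)

/-- `M N₁ … Nₙ`. -/
def appsO (M : Obj) (N : List Obj) : Obj := N.foldl Exp.appO M

/-- `A N₁ … Nₙ`. -/
def appsF (A : Fam) (N : List Obj) : Fam := N.foldl Exp.appF A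

/-- Base types `u M₁ … Mₙ`. -/
def IsBase (A : Fam) : Prop := ∃ u N, A = appsF (.tvar u) N

/-! ### Eta-long forms -/

/-- The eta-expansion of `N` at the type `A[r]`:
`N` itself if `A` is not a product, and
`λx:C[r]. (the expansion at D[r] of N (the expansion at C[r] of x))` if `A = Πx:C.D`. -/
def etaRen : {c : Cat} → Exp c → (ℕ → ℕ) → Obj → Obj
  | _, .piF C D, r, N =>
      .lamO (C.rename r)
        (etaRen D (upRen r) (.appO N.shift (etaRen C (fun x => r x + 1) (.var 0))))
  | _, _, _, N => N

/-- The eta-expansion of the object `N` at the type `A`. -/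
def eta (A : Fam) (N : Obj) : Obj := etaRen A id N

/-- `LongForm A N N'`: `N'` is the beta-eta-long form of the object `N` at the type `A`, that is,
the beta-normal form of the eta-expansion of `N` at `A`. -/
def LongForm (A : Fam) (N N' : Obj) : Prop := BetaNF (eta A N) N'

/-! ### Contexts -/

/-- A declaration `x : A` or `u : K`. -/
inductive Decl : Type
  | obj (A : Fam)
  | fam (u : ℕ) (K : Kind)

/-- Contexts; the most recent declaration comes first, and each declaration lives in the context
formed by the declarations after it in the list. -/
abbrev Ctx : Type := List Decl

/-- The number of object variables declared in a context. -/
def objCount : Ctx → ℕ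
  | [] => 0
  | .obj _ :: Γ => objCount Γ + 1
  | .fam _ _ :: Γ => objCount Γ

/-- `HasObj Γ x A`: `(x : A) ∈ Γ`. -/
inductive HasObj : Ctx → ℕ → Fam → Prop
  | here {Γ : Ctx} {A : Fam} : HasObj (.obj A :: Γ) 0 A.shift
  | skipObj {Γ : Ctx} {x : ℕ} {A B : Fam} :
      HasObj Γ x A → HasObj (.obj B :: Γ) (x + 1) A.shift
  | skipFam {Γ : Ctx} {x u : ℕ} {A : Fam} {K : Kind} :
      HasObj Γ x A → HasObj (.fam u K :: Γ) x A

/-- `HasFam Γ u K`: `(u : K) ∈ Γ`. -/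
inductive HasFam : Ctx → ℕ → Kind → Prop
  | here {Γ : Ctx} {u : ℕ} {K : Kind} : HasFam (.fam u K :: Γ) u K
  | skipObj {Γ : Ctx} {u : ℕ} {K : Kind} {B : Fam} :
      HasFam Γ u K → HasFam (.obj B :: Γ) u K.shift
  | skipFam {Γ : Ctx} {u v : ℕ} {K L : Kind} :
      HasFam Γ u K → HasFam (.fam v L :: Γ) u K

def Decl.subst (s : ℕ → Obj) : Decl → Decl
  | .obj A => .obj (A.subst s)
  | .fam u K => .fam u (K.subst s)

/-- `Δ[s]`, where `s` acts on the variables declared before `Δ`. -/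
def substCtx (s : ℕ → Obj) : Ctx → Ctx
  | [] => []
  | d :: Δ => d.subst (upN (objCount Δ) s) :: substCtx s Δ

inductive DeclNF : Decl → Decl → Prop
  | obj {A A' : Fam} : BetaNF A A' → DeclNF (.obj A) (.obj A')
  | fam {u : ℕ} {K K' : Kind} : BetaNF K K' → DeclNF (.fam u K) (.fam u K')

/-- `CtxNF Δ Δ'`: `Δ'` is obtained from `Δ` by beta-normalising every declaration. -/
def CtxNF (Δ Δ' : Ctx) : Prop := List.Forall₂ DeclNF Δ Δ'

/-- The context `x₁ : B₁, …, xₙ : Bₙ`. -/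
def telescope (B : List Fam) : Ctx := (B.map Decl.obj).reverse

/-! ### The rules of canonical LF -/

/-- The four forms of assertions: `⊢ Γ ctx`, `Γ ⊢ K kind`, `Γ ⊢ A : K`, `Γ ⊢ M : A`. -/
inductive Assertion : Type
  | ctx (Γ : Ctx)
  | kind (Γ : Ctx) (K : Kind)
  | fam (Γ : Ctx) (A : Fam) (K : Kind)
  | obj (Γ : Ctx) (M : Obj) (A : Fam)

/-- Derivability in canonical LF.  In the two backchaining rules `B' k` is the normal form of
`B_k[N₁/x₁, …, N_{k-1}/x_{k-1}]` (with `k` counted from `0`). -/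
inductive Derivable : Assertion → Prop
  | nullCtx : Derivable (.ctx [])
  | kindCtx {Γ : Ctx} {u : ℕ} {K : Kind} :
      Derivable (.kind Γ K) → Derivable (.ctx Γ) → (∀ L, ¬ HasFam Γ u L) →
      Derivable (.ctx (.fam u K :: Γ))
  | typeCtx {Γ : Ctx} {A : Fam} :
      Derivable (.fam Γ A .type) → Derivable (.ctx Γ) →
      Derivable (.ctx (.obj A :: Γ))
  | typeKind {Γ : Ctx} :
      Derivable (.ctx Γ) → Derivable (.kind Γ .type)
  | piKind {Γ : Ctx} {A : Fam} {K : Kind} :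
      Derivable (.fam Γ A .type) → Derivable (.kind (.obj A :: Γ) K) →
      Derivable (.kind Γ (.piK A K))
  | piFam {Γ : Ctx} {A B : Fam} :
      Derivable (.fam Γ A .type) → Derivable (.fam (.obj A :: Γ) B .type) →
      Derivable (.fam Γ (.piF A B) .type)
  | absFam {Γ : Ctx} {A B : Fam} {K : Kind} :
      Derivable (.fam Γ A .type) → Derivable (.fam (.obj A :: Γ) B K) →
      Derivable (.fam Γ (.lamF A B) (.piK A K))
  | absObj {Γ : Ctx} {A B : Fam} {M : Obj} :
      Derivable (.fam Γ A .type) → Derivable (.obj (.obj A :: Γ) M B) →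
      Derivable (.obj Γ (.lamO A M) (.piF A B))
  | backchainFam {Γ : Ctx} {u : ℕ} {B : List Fam} {N : List Obj} {B' : ℕ → Fam} :
      Derivable (.ctx Γ) → HasFam Γ u (pisK B .type) → N.length = B.length →
      (∀ k Bk, B[k]? = some Bk → BetaNF (Bk.subst (inst (N.take k))) (B' k)) →
      (∀ k Nk, N[k]? = some Nk → Derivable (.obj Γ Nk (B' k))) →
      Derivable (.fam Γ (appsF (.tvar u) N) .type)
  | backchainObj {Γ : Ctx} {y : ℕ} {B : List Fam} {A A' : Fam} {N : List Obj} {B' : ℕ → Fam} :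
      Derivable (.ctx Γ) → HasObj Γ y (pisF B A) → IsBase A → N.length = B.length →
      (∀ k Bk, B[k]? = some Bk → BetaNF (Bk.subst (inst (N.take k))) (B' k)) →
      (∀ k Nk, N[k]? = some Nk → Derivable (.obj Γ Nk (B' k))) →
      BetaNF (A.subst (inst N)) A' →
      Derivable (.obj Γ (appsO (.var y) N) A')

/-! ### Rigid occurrences -/

/-- `P` is the variable `y`, possibly eta-expanded. -/
def IsEtaVar (y : ℕ) (P : Obj) : Prop := ∃ A : Fam, P = eta A (.var y)

/-- `Rigid n i d M`: the judgement `x₁, …, xₙ; δ; xᵢ ⊢ M` (with `i` counted from `0`) that `xᵢ`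
occurs rigidly in `M`, in a scope whose last `d` object variables form `δ` (indices `< d`) and
where `x₁, …, xₙ` are declared just before them (so `xᵢ` has index `d + (n - 1 - i)`). -/
inductive Rigid (n i : ℕ) : ℕ → Obj → Prop
  | init {d : ℕ} {y : List ℕ} {P : List Obj} :
      (∀ z ∈ y, z < d) → y.Nodup → List.Forall₂ IsEtaVar y P →
      Rigid n i d (appsO (.var (d + (n - 1 - i))) P)
  | app {d y : ℕ} {M : List Obj} {Mk : Obj} :
      (y < d ∨ d + n ≤ y) → Mk ∈ M → Rigid n i d Mk →
      Rigid n i d (appsO (.var y) M)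
  | abs {d : ℕ} {A : Fam} {M : Obj} :
      Rigid n i (d + 1) M → Rigid n i d (.lamO A M)

end CanonicalLF

namespace CanonicalLF

/-! ### The substitution calculus -/

variable {c : Cat}

/-! The rigid path is followed in the two given derivations at once, the generic one for `M` and the
one for its instance `M'`. A head off the vector `x` stays a variable under the substitution, so
both derivations end in backchaining on corresponding heads with convertible declared types.
Convertible products have convertible domains, so the arguments on the path are again typed in
parallel (`Spine.exists_instance`, `Rigid.exists_longForm`).

The path ends at `xᵢ y₁ … yₖ`. The generic derivation shows that `Bᵢ` is a product whose `k` domains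
are the declared types of the `yⱼ` and whose target is a base type. The instance derivation types
the normal form of `Nᵢ y₁ … yₖ` at the instance of that target. Abstracting over the distinct `yⱼ`
yields the long form of `Nᵢ` at `Bᵢ'`, with its typing. Since `Nᵢ` and `Bᵢ` do not mention `Δ`,
everything can be moved into `Γ` extended by the `yⱼ` alone (`VarSpine.exists_longForm`).

Four facts support this. Canonical subjects, and the types of canonical objects, are normal. With
confluence, this provides the normal forms needed in the conclusion without any normalisation
theorem. Substituting eta-expanded variables in a canonical expression amounts to renaming it
(`Derivable.etaStable`), so arguments written as expansions do not disturb dependent types. An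
eta-expanded variable that has a type at all is expanded at its declared type (`etaVarsTyped`).
Finally, canonical derivations can be strengthened (`Derivable.strengthenable`); the invariant
`Skel` keeps track of the type variables that occur as heads in types. -/

/-- Extension of a renaming or substitution by a value for the variable `0`. -/
def scons {α : Type} (a : α) (s : ℕ → α) : ℕ → α
  | 0 => a
  | n + 1 => s n

@[simp] theorem scons_zero {α : Type} (a : α) (s : ℕ → α) : scons a s 0 = a := rfl
@[simp] theorem scons_succ {α : Type} (a : α) (s : ℕ → α) (n : ℕ) : scons a s (n + 1) = s n := rfl

@[simp] theorem upRen_zero (r : ℕ → ℕ) : upRen r 0 = 0 := rfl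
@[simp] theorem upRen_succ (r : ℕ → ℕ) (n : ℕ) : upRen r (n + 1) = r n + 1 := rfl
@[simp] theorem up_zero (s : ℕ → Obj) : up s 0 = .var 0 := rfl
@[simp] theorem up_succ (s : ℕ → Obj) (n : ℕ) : up s (n + 1) = (s n).shift := rfl

theorem upRen_comp (r s : ℕ → ℕ) : upRen (fun x => r (s x)) = fun x => upRen r (upRen s x) := by
  funext x; cases x <;> rfl

theorem upRen_id : upRen (fun x => x) = fun x => x := by
  funext x; cases x <;> rfl

theorem rename_rename (e : Exp c) (r s : ℕ → ℕ) :
    (e.rename s).rename r = e.rename (fun x => r (s x)) := by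
  induction e generalizing r s <;> simp_all [Exp.rename, upRen_comp]

theorem rename_id (e : Exp c) : e.rename (fun x => x) = e := by
  induction e <;> simp_all [Exp.rename, upRen_id]

theorem up_var : up Exp.var = Exp.var := by
  funext x; cases x <;> rfl

theorem up_comp_ren (s : ℕ → Obj) (r : ℕ → ℕ) :
    up (fun x => s (r x)) = fun x => up s (upRen r x) := by
  funext x; cases x <;> rfl

theorem subst_rename (e : Exp c) (s : ℕ → Obj) (r : ℕ → ℕ) :
    (e.rename r).subst s = e.subst (fun x => s (r x)) := by
  induction e generalizing r s <;> simp_all [Exp.rename, Exp.subst, up_comp_ren]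

theorem shift_rename_upRen (e : Exp c) (r : ℕ → ℕ) :
    e.shift.rename (upRen r) = (e.rename r).shift := by
  simp [Exp.shift, rename_rename]

theorem ren_comp_up (s : ℕ → Obj) (r : ℕ → ℕ) :
    up (fun x => (s x).rename r) = fun x => (up s x).rename (upRen r) := by
  funext x
  cases x with
  | zero => rfl
  | succ n => simp [shift_rename_upRen]

theorem rename_subst (e : Exp c) (s : ℕ → Obj) (r : ℕ → ℕ) :
    (e.subst s).rename r = e.subst (fun x => (s x).rename r) := by
  induction e generalizing r s <;> simp_all [Exp.rename, Exp.subst, ren_comp_up]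

theorem shift_subst_up (e : Exp c) (s : ℕ → Obj) : e.shift.subst (up s) = (e.subst s).shift := by
  simp [Exp.shift, subst_rename, rename_subst]

theorem up_comp (s t : ℕ → Obj) :
    up (fun x => (s x).subst t) = fun x => (up s x).subst (up t) := by
  funext x
  cases x with
  | zero => rfl
  | succ n => simp [shift_subst_up]

theorem subst_subst (e : Exp c) (s t : ℕ → Obj) :
    (e.subst s).subst t = e.subst (fun x => (s x).subst t) := by
  induction e generalizing s t <;> simp_all [Exp.subst, up_comp]

theorem subst_var (e : Exp c) : e.subst Exp.var = e := by
  induction e <;> simp_all [Exp.subst, up_var]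

theorem up_ren (r : ℕ → ℕ) : up (fun x => .var (r x)) = fun x => .var (upRen r x) := by
  funext x; cases x <;> rfl

theorem subst_ren (e : Exp c) (r : ℕ → ℕ) : e.subst (fun x => .var (r x)) = e.rename r := by
  induction e generalizing r <;> simp_all [Exp.subst, Exp.rename, up_ren]

theorem shift_subst (e : Exp c) (s : ℕ → Obj) :
    e.shift.subst s = e.subst (fun x => s (x + 1)) := subst_rename e s _

theorem shift_subst_scons (e : Exp c) (a : Obj) (s : ℕ → Obj) :
    e.shift.subst (scons a s) = e.subst s := shift_subst _ _

theorem shift_rename (e : Exp c) (r : ℕ → ℕ) :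
    e.shift.rename r = e.rename (fun x => r (x + 1)) := rename_rename e r _

theorem shift_rename_scons (e : Exp c) (a : ℕ) (r : ℕ → ℕ) :
    e.shift.rename (scons a r) = e.rename r := shift_rename _ _

theorem inst_singleton (N : Obj) : inst [N] = scons N Exp.var := by
  funext x; cases x <;> simp [inst]

theorem subst_up_scons (e : Exp c) (s : ℕ → Obj) (N : Obj) :
    (e.subst (up s)).subst (scons N .var) = e.subst (scons N s) := by
  rw [subst_subst]
  congr 1; funext x
  cases x with
  | zero => rfl
  | succ n => simp [shift_subst_scons, subst_var]

theorem subst_scons_subst (e : Exp c) (s : ℕ → Obj) (N : Obj) :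
    (e.subst (scons N .var)).subst s = (e.subst (up s)).subst (scons (N.subst s) .var) := by
  rw [subst_up_scons, subst_subst]
  congr 1; funext x
  cases x <;> simp [Exp.subst]

theorem subst_scons_rename (e : Exp c) (r : ℕ → ℕ) (N : Obj) :
    (e.subst (scons N .var)).rename r =
      (e.rename (upRen r)).subst (scons (N.rename r) .var) := by
  simp only [← subst_ren, subst_scons_subst, up_ren]

theorem upRen_injective {r : ℕ → ℕ} (hr : Function.Injective r) :
    Function.Injective (upRen r) := by
  intro x y h
  cases x <;> cases y <;> simp_all
  exact hr h

theorem rename_injective {r : ℕ → ℕ} (hr : Function.Injective r) {e e' : Exp c}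
    (h : e.rename r = e'.rename r) : e = e' := by
  induction e generalizing r with
  | type => cases e'; rfl; simp [Exp.rename] at h
  | var x => cases e' <;> simp_all [Exp.rename]; exact hr h
  | tvar x => cases e' <;> simp_all [Exp.rename]
  | piK A K h1 h2 =>
    cases e' <;> simp only [Exp.rename, reduceCtorEq, Exp.piK.injEq] at h
    rw [h1 hr h.1, h2 (upRen_injective hr) h.2]
  | piF A K h1 h2 =>
    cases e' <;> simp only [Exp.rename, reduceCtorEq, Exp.piF.injEq] at h
    rw [h1 hr h.1, h2 (upRen_injective hr) h.2]
  | lamF A K h1 h2 =>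
    cases e' <;> simp only [Exp.rename, reduceCtorEq, Exp.lamF.injEq] at h
    rw [h1 hr h.1, h2 (upRen_injective hr) h.2]
  | lamO A K h1 h2 =>
    cases e' <;> simp only [Exp.rename, reduceCtorEq, Exp.lamO.injEq] at h
    rw [h1 hr h.1, h2 (upRen_injective hr) h.2]
  | appF A K h1 h2 =>
    cases e' <;> simp only [Exp.rename, reduceCtorEq, Exp.appF.injEq] at h
    rw [h1 hr h.1, h2 hr h.2]
  | appO A K h1 h2 =>
    cases e' <;> simp only [Exp.rename, reduceCtorEq, Exp.appO.injEq] at h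
    rw [h1 hr h.1, h2 hr h.2]

theorem shift_injective {e e' : Exp c} (h : e.shift = e'.shift) : e = e' :=
  rename_injective Nat.succ_injective h

/-! ### Confluence of beta-reduction -/

/-- Parallel beta-reduction. -/
inductive Par : {c : Cat} → Exp c → Exp c → Prop
  | type : Par .type .type
  | tvar (u : ℕ) : Par (.tvar u) (.tvar u)
  | var (x : ℕ) : Par (.var x) (.var x)
  | piK {A A' : Fam} {K K' : Kind} : Par A A' → Par K K' → Par (.piK A K) (.piK A' K')
  | piF {A A' B B' : Fam} : Par A A' → Par B B' → Par (.piF A B) (.piF A' B')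
  | lamF {A A' B B' : Fam} : Par A A' → Par B B' → Par (.lamF A B) (.lamF A' B')
  | appF {A A' : Fam} {M M' : Obj} : Par A A' → Par M M' → Par (.appF A M) (.appF A' M')
  | lamO {A A' : Fam} {M M' : Obj} : Par A A' → Par M M' → Par (.lamO A M) (.lamO A' M')
  | appO {M M' N N' : Obj} : Par M M' → Par N N' → Par (.appO M N) (.appO M' N')
  | betaF {A B B' : Fam} {M M' : Obj} : Par B B' → Par M M' →
      Par (.appF (.lamF A B) M) (B'.subst (scons M' .var))
  | betaO {A : Fam} {M M' N N' : Obj} : Par M M' → Par N N' →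
      Par (.appO (.lamO A M) N) (M'.subst (scons N' .var))

theorem Par.refl (e : Exp c) : Par e e := by
  induction e <;> constructor <;> assumption

theorem Par.rename {e e' : Exp c} (h : Par e e') (r : ℕ → ℕ) :
    Par (e.rename r) (e'.rename r) := by
  induction h generalizing r with
  | betaF _ _ h1 h2 =>
    rw [subst_scons_rename]; exact .betaF (h1 _) (h2 _)
  | betaO _ _ h1 h2 =>
    rw [subst_scons_rename]; exact .betaO (h1 _) (h2 _)
  | type => exact .type
  | tvar u => exact .tvar u
  | var x => exact .var _
  | _ => simp only [Exp.rename]; constructor <;> simp_all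

theorem Par.up {s t : ℕ → Obj} (h : ∀ x, Par (s x) (t x)) (x : ℕ) :
    Par (up s x) (up t x) := by
  cases x with
  | zero => exact .var 0
  | succ n => exact (h n).rename _

theorem Par.subst {e e' : Exp c} (h : Par e e') {s t : ℕ → Obj} (hs : ∀ x, Par (s x) (t x)) :
    Par (e.subst s) (e'.subst t) := by
  induction h generalizing s t with
  | betaF _ _ h1 h2 =>
    rw [subst_scons_subst]; exact .betaF (h1 (Par.up hs)) (h2 hs)
  | betaO _ _ h1 h2 =>
    rw [subst_scons_subst]; exact .betaO (h1 (Par.up hs)) (h2 hs)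
  | type => exact .type
  | tvar u => exact .tvar u
  | var x => exact hs x
  | piK _ _ h1 h2 => exact .piK (h1 hs) (h2 (Par.up hs))
  | piF _ _ h1 h2 => exact .piF (h1 hs) (h2 (Par.up hs))
  | lamF _ _ h1 h2 => exact .lamF (h1 hs) (h2 (Par.up hs))
  | lamO _ _ h1 h2 => exact .lamO (h1 hs) (h2 (Par.up hs))
  | appF _ _ h1 h2 => exact .appF (h1 hs) (h2 hs)
  | appO _ _ h1 h2 => exact .appO (h1 hs) (h2 hs)

theorem Par.scons {M M' : Obj} (h : Par M M') (x : ℕ) :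
    Par (scons M .var x) (scons M' .var x) := by
  cases x with
  | zero => exact h
  | succ n => exact .var n

/-- Complete development: contraction of all redexes of an expression. -/
def develop : {c : Cat} → Exp c → Exp c
  | _, .type => .type
  | _, .piK A K => .piK (develop A) (develop K)
  | _, .tvar u => .tvar u
  | _, .piF A B => .piF (develop A) (develop B)
  | _, .lamF A B => .lamF (develop A) (develop B)
  | _, .appF (.lamF _ B) M => (develop B).subst (scons (develop M) .var)
  | _, .appF A M => .appF (develop A) (develop M)
  | _, .var x => .var x
  | _, .lamO A M => .lamO (develop A) (develop M)
  | _, .appO (.lamO _ M) N => (develop M).subst (scons (develop N) .var)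
  | _, .appO M N => .appO (develop M) (develop N)

/-- Takahashi's triangle property: the target depends on `e` only, so any two parallel reducts of
`e` meet there, which gives the diamond property. -/
theorem Par.develop {e e' : Exp c} (h : Par e e') : Par e' (develop e) := by
  induction h with
  | betaF _ _ h1 h2 => exact h1.subst (Par.scons h2)
  | betaO _ _ h1 h2 => exact h1.subst (Par.scons h2)
  | type => exact .type
  | tvar u => exact .tvar u
  | var x => exact .var x
  | piK _ _ h1 h2 => exact .piK h1 h2
  | piF _ _ h1 h2 => exact .piF h1 h2
  | lamF _ _ h1 h2 => exact .lamF h1 h2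
  | lamO _ _ h1 h2 => exact .lamO h1 h2
  | @appF A A' M M' hA _ h1 h2 =>
    cases A with
    | lamF =>
      cases hA
      cases h1 with
      | lamF _ h => exact .betaF h h2
    | _ => exact .appF h1 h2
  | @appO A A' M M' hA _ h1 h2 =>
    cases A with
    | lamO =>
      cases hA
      cases h1 with
      | lamO _ h => exact .betaO h h2
    | _ => exact .appO h1 h2

/-- Many-step beta-reduction. -/
abbrev Red (e e' : Exp c) : Prop := Relation.ReflTransGen Step e e'

theorem Step.par {e e' : Exp c} (h : Step e e') : Par e e' := by
  induction h with
  | betaF => rw [inst_singleton]; exact .betaF (.refl _) (.refl _)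
  | betaO => rw [inst_singleton]; exact .betaO (.refl _) (.refl _)
  | piK₁ _ h => exact .piK h (.refl _)
  | piK₂ _ h => exact .piK (.refl _) h
  | piF₁ _ h => exact .piF h (.refl _)
  | piF₂ _ h => exact .piF (.refl _) h
  | lamF₁ _ h => exact .lamF h (.refl _)
  | lamF₂ _ h => exact .lamF (.refl _) h
  | appF₁ _ h => exact .appF h (.refl _)
  | appF₂ _ h => exact .appF (.refl _) h
  | lamO₁ _ h => exact .lamO h (.refl _)
  | lamO₂ _ h => exact .lamO (.refl _) h
  | appO₁ _ h => exact .appO h (.refl _)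
  | appO₂ _ h => exact .appO (.refl _) h

/-! ### Many-step reduction is a congruence; Church-Rosser -/

theorem Red.piK {A A' : Fam} {K K' : Kind} (h1 : Red A A') (h2 : Red K K') :
    Red (Exp.piK A K) (.piK A' K') :=
  (h1.lift (Exp.piK · K) fun _ _ h => .piK₁ h).trans (h2.lift (Exp.piK A') fun _ _ h => .piK₂ h)

theorem Red.piF {A A' B B' : Fam} (h1 : Red A A') (h2 : Red B B') :
    Red (Exp.piF A B) (.piF A' B') :=
  (h1.lift (Exp.piF · B) fun _ _ h => .piF₁ h).trans (h2.lift (Exp.piF A') fun _ _ h => .piF₂ h)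

theorem Red.lamF {A A' B B' : Fam} (h1 : Red A A') (h2 : Red B B') :
    Red (Exp.lamF A B) (.lamF A' B') :=
  (h1.lift (Exp.lamF · B) fun _ _ h => .lamF₁ h).trans
    (h2.lift (Exp.lamF A') fun _ _ h => .lamF₂ h)

theorem Red.appF {A A' : Fam} {M M' : Obj} (h1 : Red A A') (h2 : Red M M') :
    Red (Exp.appF A M) (.appF A' M') :=
  (h1.lift (Exp.appF · M) fun _ _ h => .appF₁ h).trans
    (h2.lift (Exp.appF A') fun _ _ h => .appF₂ h)

theorem Red.lamO {A A' : Fam} {M M' : Obj} (h1 : Red A A') (h2 : Red M M') :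
    Red (Exp.lamO A M) (.lamO A' M') :=
  (h1.lift (Exp.lamO · M) fun _ _ h => .lamO₁ h).trans
    (h2.lift (Exp.lamO A') fun _ _ h => .lamO₂ h)

theorem Red.appO {M M' N N' : Obj} (h1 : Red M M') (h2 : Red N N') :
    Red (Exp.appO M N) (.appO M' N') :=
  (h1.lift (Exp.appO · N) fun _ _ h => .appO₁ h).trans
    (h2.lift (Exp.appO M') fun _ _ h => .appO₂ h)

theorem Par.red {e e' : Exp c} (h : Par e e') : Red e e' := by
  induction h with
  | @betaF A B B' M M' _ _ h1 h2 =>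
    refine (Red.appF (Red.lamF .refl h1) h2).tail ?_
    rw [← inst_singleton]; exact .betaF _ _ _
  | @betaO A B B' M M' _ _ h1 h2 =>
    refine (Red.appO (Red.lamO .refl h1) h2).tail ?_
    rw [← inst_singleton]; exact .betaO _ _ _
  | type => exact .refl
  | tvar u => exact .refl
  | var x => exact .refl
  | piK _ _ h1 h2 => exact .piK h1 h2
  | piF _ _ h1 h2 => exact .piF h1 h2
  | lamF _ _ h1 h2 => exact .lamF h1 h2
  | lamO _ _ h1 h2 => exact .lamO h1 h2
  | appF _ _ h1 h2 => exact .appF h1 h2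
  | appO _ _ h1 h2 => exact .appO h1 h2

theorem red_iff_par {e e' : Exp c} : Red e e' ↔ Relation.ReflTransGen Par e e' := by
  constructor
  · exact fun h => h.lift id fun _ _ => Step.par
  · intro h
    induction h with
    | refl => exact .refl
    | tail _ h ih => exact ih.trans h.red

theorem Red.confluent {e a b : Exp c} (ha : Red e a) (hb : Red e b) :
    ∃ d, Red a d ∧ Red b d := by
  obtain ⟨d, h1, h2⟩ := Relation.church_rosser
    (fun a b b' (h : Par a b) (h' : Par a b') =>
      ⟨develop a, Relation.ReflGen.single h.develop, Relation.ReflTransGen.single h'.develop⟩)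
    (red_iff_par.1 ha) (red_iff_par.1 hb)
  exact ⟨d, red_iff_par.2 h1, red_iff_par.2 h2⟩

theorem Red.subst {e e' : Exp c} (h : Red e e') (s : ℕ → Obj) :
    Red (e.subst s) (e'.subst s) :=
  red_iff_par.2 ((red_iff_par.1 h).lift _ fun _ _ h => h.subst fun _ => .refl _)

theorem Red.rename {e e' : Exp c} (h : Red e e') (r : ℕ → ℕ) :
    Red (e.rename r) (e'.rename r) :=
  red_iff_par.2 ((red_iff_par.1 h).lift _ fun _ _ h => h.rename r)

theorem Red.up {s t : ℕ → Obj} (h : ∀ x, Red (s x) (t x)) (x : ℕ) :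
    Red (up s x) (up t x) := by
  cases x with
  | zero => exact .refl
  | succ n => exact (h n).rename _

theorem Red.subst_right (e : Exp c) {s t : ℕ → Obj} (h : ∀ x, Red (s x) (t x)) :
    Red (e.subst s) (e.subst t) := by
  induction e generalizing s t with
  | type => exact .refl
  | tvar u => exact .refl
  | var x => exact h x
  | piK _ _ h1 h2 => exact .piK (h1 h) (h2 (Red.up h))
  | piF _ _ h1 h2 => exact .piF (h1 h) (h2 (Red.up h))
  | lamF _ _ h1 h2 => exact .lamF (h1 h) (h2 (Red.up h))
  | lamO _ _ h1 h2 => exact .lamO (h1 h) (h2 (Red.up h))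
  | appF _ _ h1 h2 => exact .appF (h1 h) (h2 h)
  | appO _ _ h1 h2 => exact .appO (h1 h) (h2 h)

/-! ### Normal forms and convertibility -/

/-- Expressions without beta-redexes. -/
def Normal (e : Exp c) : Prop := ∀ e', ¬ Step e e'

theorem Normal.eq_of_red {e e' : Exp c} (h : Normal e) (hr : Red e e') : e' = e := by
  cases hr using Relation.ReflTransGen.head_induction_on with
  | refl => rfl
  | head h1 _ => exact absurd h1 (h _)

/-- Beta-convertibility, as the existence of a common reduct. -/
def Conv (e e' : Exp c) : Prop := ∃ d, Red e d ∧ Red e' d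

theorem Conv.refl (e : Exp c) : Conv e e := ⟨e, .refl, .refl⟩

theorem Conv.of_eq {e e' : Exp c} (h : e = e') : Conv e e' := h ▸ .refl e

theorem Conv.symm {e e' : Exp c} : Conv e e' → Conv e' e := fun ⟨d, h, h'⟩ => ⟨d, h', h⟩

/-- Confluence joins the two reducts of the middle expression. -/
theorem Conv.trans {a b e : Exp c} : Conv a b → Conv b e → Conv a e := by
  rintro ⟨d, h1, h2⟩ ⟨d', h3, h4⟩
  obtain ⟨f, h5, h6⟩ := h2.confluent h3
  exact ⟨f, h1.trans h5, h4.trans h6⟩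

theorem Red.conv {e e' : Exp c} (h : Red e e') : Conv e e' := ⟨e', h, .refl⟩

theorem Conv.subst {e e' : Exp c} (h : Conv e e') {s t : ℕ → Obj} (hs : ∀ x, Conv (s x) (t x)) :
    Conv (e.subst s) (e'.subst t) := by
  obtain ⟨d, h1, h2⟩ := h
  choose u hu1 hu2 using hs
  exact ⟨d.subst u, (h1.subst s).trans (Red.subst_right d hu1),
    (h2.subst t).trans (Red.subst_right d hu2)⟩

theorem Conv.subst_left {e e' : Exp c} (h : Conv e e') (s : ℕ → Obj) :
    Conv (e.subst s) (e'.subst s) := h.subst fun _ => .refl _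

theorem Conv.rename {e e' : Exp c} (h : Conv e e') (r : ℕ → ℕ) :
    Conv (e.rename r) (e'.rename r) :=
  let ⟨d, h1, h2⟩ := h; ⟨d.rename r, h1.rename r, h2.rename r⟩

theorem Conv.scons {M M' : Obj} (h : Conv M M') {s t : ℕ → Obj} (hs : ∀ x, Conv (s x) (t x))
    (x : ℕ) : Conv (scons M s x) (CanonicalLF.scons M' t x) := by
  cases x with
  | zero => exact h
  | succ n => exact hs n

theorem Conv.piF {A A' B B' : Fam} (h1 : Conv A A') (h2 : Conv B B') :
    Conv (Exp.piF A B) (.piF A' B') :=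
  let ⟨_, a, b⟩ := h1; let ⟨_, a', b'⟩ := h2; ⟨_, .piF a a', .piF b b'⟩

theorem Conv.lamF {A A' B B' : Fam} (h1 : Conv A A') (h2 : Conv B B') :
    Conv (Exp.lamF A B) (.lamF A' B') :=
  let ⟨_, a, b⟩ := h1; let ⟨_, a', b'⟩ := h2; ⟨_, .lamF a a', .lamF b b'⟩

theorem Conv.lamO {A A' : Fam} {M M' : Obj} (h1 : Conv A A') (h2 : Conv M M') :
    Conv (Exp.lamO A M) (.lamO A' M') :=
  let ⟨_, a, b⟩ := h1; let ⟨_, a', b'⟩ := h2; ⟨_, .lamO a a', .lamO b b'⟩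

theorem Conv.appF {A A' : Fam} {M M' : Obj} (h1 : Conv A A') (h2 : Conv M M') :
    Conv (Exp.appF A M) (.appF A' M') :=
  let ⟨_, a, b⟩ := h1; let ⟨_, a', b'⟩ := h2; ⟨_, .appF a a', .appF b b'⟩

theorem Conv.appO {M M' N N' : Obj} (h1 : Conv M M') (h2 : Conv N N') :
    Conv (Exp.appO M N) (.appO M' N') :=
  let ⟨_, a, b⟩ := h1; let ⟨_, a', b'⟩ := h2; ⟨_, .appO a a', .appO b b'⟩

theorem Conv.appsO {M M' : Obj} (h : Conv M M') {N N' : List Obj}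
    (hN : List.Forall₂ Conv N N') : Conv (appsO M N) (appsO M' N') := by
  induction hN generalizing M M' with
  | nil => exact h
  | cons h1 _ ih => exact ih (h.appO h1)

theorem Conv.appsF {A A' : Fam} (h : Conv A A') {N N' : List Obj}
    (hN : List.Forall₂ Conv N N') : Conv (appsF A N) (appsF A' N') := by
  induction hN generalizing A A' with
  | nil => exact h
  | cons h1 _ ih => exact ih (h.appF h1)

theorem conv_betaO (A : Fam) (M N : Obj) :
    Conv (Exp.appO (.lamO A M) N) (M.subst (CanonicalLF.scons N .var)) := by
  rw [← inst_singleton]; exact Red.conv (.single (.betaO A M N))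

theorem BetaNF.conv {e e' : Exp c} (h : BetaNF e e') : Conv e e' := Red.conv h.1

/-- The source of normal forms in the main argument: an expression has one as soon as it is
convertible to a normal expression already at hand. -/
theorem Conv.betaNF {e e' : Exp c} (h : Conv e e') (hn : Normal e') : BetaNF e e' := by
  obtain ⟨d, h1, h2⟩ := h
  rw [hn.eq_of_red h2] at h1
  exact ⟨h1, hn⟩

theorem Conv.eq_of_normal {e e' : Exp c} (h : Conv e e') (hn : Normal e) (hn' : Normal e') :
    e = e' := (hn.eq_of_red (h.betaNF hn').1).symm

theorem BetaNF.unique {e a b : Exp c} (ha : BetaNF e a) (hb : BetaNF e b) : a = b :=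
  (ha.conv.symm.trans hb.conv).eq_of_normal ha.2 hb.2

/-! ### Reduction and renaming -/

theorem rename_subst_inst (e : Exp c) (r : ℕ → ℕ) (N : Obj) :
    (e.subst (inst [N])).rename r = (e.rename (upRen r)).subst (inst [N.rename r]) := by
  simp only [inst_singleton, subst_scons_rename]

theorem Step.rename {e e' : Exp c} (h : Step e e') (r : ℕ → ℕ) :
    Step (e.rename r) (e'.rename r) := by
  induction h generalizing r with
  | betaF => rw [rename_subst_inst]; exact .betaF _ _ _
  | betaO => rw [rename_subst_inst]; exact .betaO _ _ _
  | piK₁ _ h => exact .piK₁ (h _)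
  | piK₂ _ h => exact .piK₂ (h _)
  | piF₁ _ h => exact .piF₁ (h _)
  | piF₂ _ h => exact .piF₂ (h _)
  | lamF₁ _ h => exact .lamF₁ (h _)
  | lamF₂ _ h => exact .lamF₂ (h _)
  | appF₁ _ h => exact .appF₁ (h _)
  | appF₂ _ h => exact .appF₂ (h _)
  | lamO₁ _ h => exact .lamO₁ (h _)
  | lamO₂ _ h => exact .lamO₂ (h _)
  | appO₁ _ h => exact .appO₁ (h _)
  | appO₂ _ h => exact .appO₂ (h _)

/-- A renaming preserves and reflects the outermost constructor, so it creates no redex; injectivity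
is not needed. -/
theorem Step.of_rename {e : Exp c} {d : Exp c} {r : ℕ → ℕ} (h : Step (e.rename r) d) :
    ∃ e', Step e e' ∧ d = e'.rename r := by
  induction e generalizing r with
  | type => cases h
  | tvar => cases h
  | var => cases h
  | piK A K h1 h2 =>
    cases h with
    | piK₁ h => obtain ⟨e', h', rfl⟩ := h1 h; exact ⟨_, .piK₁ h', rfl⟩
    | piK₂ h => obtain ⟨e', h', rfl⟩ := h2 h; exact ⟨_, .piK₂ h', rfl⟩
  | piF A K h1 h2 =>
    cases h with
    | piF₁ h => obtain ⟨e', h', rfl⟩ := h1 h; exact ⟨_, .piF₁ h', rfl⟩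
    | piF₂ h => obtain ⟨e', h', rfl⟩ := h2 h; exact ⟨_, .piF₂ h', rfl⟩
  | lamF A K h1 h2 =>
    cases h with
    | lamF₁ h => obtain ⟨e', h', rfl⟩ := h1 h; exact ⟨_, .lamF₁ h', rfl⟩
    | lamF₂ h => obtain ⟨e', h', rfl⟩ := h2 h; exact ⟨_, .lamF₂ h', rfl⟩
  | lamO A K h1 h2 =>
    cases h with
    | lamO₁ h => obtain ⟨e', h', rfl⟩ := h1 h; exact ⟨_, .lamO₁ h', rfl⟩
    | lamO₂ h => obtain ⟨e', h', rfl⟩ := h2 h; exact ⟨_, .lamO₂ h', rfl⟩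
  | appF A M h1 h2 =>
    rw [Exp.rename] at h
    generalize hA : A.rename r = A' at h
    cases h with
    | betaF B C =>
      cases A <;> simp only [Exp.rename, reduceCtorEq, Exp.lamF.injEq] at hA
      obtain ⟨rfl, rfl⟩ := hA
      exact ⟨_, .betaF _ _ _, (rename_subst_inst _ _ _).symm⟩
    | appF₁ h => subst hA; obtain ⟨e', h', rfl⟩ := h1 h; exact ⟨_, .appF₁ h', rfl⟩
    | appF₂ h => subst hA; obtain ⟨e', h', rfl⟩ := h2 h; exact ⟨_, .appF₂ h', rfl⟩
  | appO A M h1 h2 =>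
    rw [Exp.rename] at h
    generalize hA : A.rename r = A' at h
    cases h with
    | betaO B C =>
      cases A <;> simp only [Exp.rename, reduceCtorEq, Exp.lamO.injEq] at hA
      obtain ⟨rfl, rfl⟩ := hA
      exact ⟨_, .betaO _ _ _, (rename_subst_inst _ _ _).symm⟩
    | appO₁ h => subst hA; obtain ⟨e', h', rfl⟩ := h1 h; exact ⟨_, .appO₁ h', rfl⟩
    | appO₂ h => subst hA; obtain ⟨e', h', rfl⟩ := h2 h; exact ⟨_, .appO₂ h', rfl⟩

theorem Normal.rename {e : Exp c} (h : Normal e) (r : ℕ → ℕ) : Normal (e.rename r) := by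
  intro d hd
  obtain ⟨e', h', _⟩ := hd.of_rename
  exact h _ h'

/-- A normal form computed in a larger context mentions only images of the original variables, so it
can be pulled back to the smaller context. -/
theorem BetaNF.of_rename {e d : Exp c} {r : ℕ → ℕ} (h : BetaNF (e.rename r) d) :
    ∃ e', BetaNF e e' ∧ d = e'.rename r := by
  obtain ⟨h1, h2⟩ := h
  have : ∃ e', Red e e' ∧ d = e'.rename r := by
    clear h2
    induction h1 with
    | refl => exact ⟨e, .refl, rfl⟩
    | tail _ h ih =>
      obtain ⟨e', h', rfl⟩ := ih
      obtain ⟨e'', h'', rfl⟩ := h.of_rename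
      exact ⟨e'', h'.tail h'', rfl⟩
  obtain ⟨e', h', rfl⟩ := this
  exact ⟨e', ⟨h', fun _ h => h2 _ (h.rename r)⟩, rfl⟩

theorem BetaNF.rename {e e' : Exp c} (h : BetaNF e e') (r : ℕ → ℕ) :
    BetaNF (e.rename r) (e'.rename r) := ⟨Red.rename h.1 r, Normal.rename h.2 r⟩

/-! ### Reduction of products, abstractions and applied variables -/

theorem Red.piF_inv {A B X : Fam} (h : Red (Exp.piF A B) X) :
    ∃ A' B', X = .piF A' B' ∧ Red A A' ∧ Red B B' := by
  induction h with
  | refl => exact ⟨A, B, rfl, .refl, .refl⟩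
  | tail _ h ih =>
    obtain ⟨A', B', rfl, h1, h2⟩ := ih
    cases h with
    | piF₁ h => exact ⟨_, _, rfl, h1.tail h, h2⟩
    | piF₂ h => exact ⟨_, _, rfl, h1, h2.tail h⟩

theorem Red.lamO_inv {A : Fam} {B X : Obj} (h : Red (Exp.lamO A B) X) :
    ∃ A' B', X = .lamO A' B' ∧ Red A A' ∧ Red B B' := by
  induction h with
  | refl => exact ⟨A, B, rfl, .refl, .refl⟩
  | tail _ h ih =>
    obtain ⟨A', B', rfl, h1, h2⟩ := ih
    cases h with
    | lamO₁ h => exact ⟨_, _, rfl, h1.tail h, h2⟩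
    | lamO₂ h => exact ⟨_, _, rfl, h1, h2.tail h⟩

theorem Conv.piF_inj {A A' B B' : Fam} (h : Conv (Exp.piF A B) (.piF A' B')) :
    Conv A A' ∧ Conv B B' := by
  obtain ⟨d, h1, h2⟩ := h
  obtain ⟨_, _, rfl, h3, h4⟩ := h1.piF_inv
  obtain ⟨_, _, h, h5, h6⟩ := h2.piF_inv
  cases h
  exact ⟨⟨_, h3, h5⟩, ⟨_, h4, h6⟩⟩

theorem Normal.piF {A B : Fam} (h1 : Normal A) (h2 : Normal B) : Normal (Exp.piF A B) := by
  intro X h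
  cases h with
  | piF₁ h => exact h1 _ h
  | piF₂ h => exact h2 _ h

theorem Normal.lamO {A : Fam} {B : Obj} (h1 : Normal A) (h2 : Normal B) :
    Normal (Exp.lamO A B) := by
  intro X h
  cases h with
  | lamO₁ h => exact h1 _ h
  | lamO₂ h => exact h2 _ h

theorem Normal.piF_inv {A B : Fam} (h : Normal (Exp.piF A B)) : Normal A ∧ Normal B :=
  ⟨fun _ h' => h _ (.piF₁ h'), fun _ h' => h _ (.piF₂ h')⟩

theorem Normal.lamO_inv {A : Fam} {B : Obj} (h : Normal (Exp.lamO A B)) : Normal A ∧ Normal B :=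
  ⟨fun _ h' => h _ (.lamO₁ h'), fun _ h' => h _ (.lamO₂ h')⟩

theorem BetaNF.piF_inv {A B X : Fam} (h : BetaNF (Exp.piF A B) X) :
    ∃ A' B', X = .piF A' B' ∧ BetaNF A A' ∧ BetaNF B B' := by
  obtain ⟨h1, h2⟩ := h
  obtain ⟨A', B', rfl, h3, h4⟩ := Red.piF_inv h1
  exact ⟨_, _, rfl, ⟨h3, (Normal.piF_inv h2).1⟩, ⟨h4, (Normal.piF_inv h2).2⟩⟩

theorem BetaNF.lamO_inv {A : Fam} {B X : Obj} (h : BetaNF (Exp.lamO A B) X) :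
    ∃ A' B', X = .lamO A' B' ∧ BetaNF A A' ∧ BetaNF B B' := by
  obtain ⟨h1, h2⟩ := h
  obtain ⟨A', B', rfl, h3, h4⟩ := Red.lamO_inv h1
  exact ⟨_, _, rfl, ⟨h3, (Normal.lamO_inv h2).1⟩, ⟨h4, (Normal.lamO_inv h2).2⟩⟩

theorem BetaNF.piF {A A' B B' : Fam} (h1 : BetaNF A A') (h2 : BetaNF B B') :
    BetaNF (Exp.piF A B) (.piF A' B') := ⟨Red.piF h1.1 h2.1, Normal.piF h1.2 h2.2⟩

theorem BetaNF.lamO {A A' : Fam} {B B' : Obj} (h1 : BetaNF A A') (h2 : BetaNF B B') :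
    BetaNF (Exp.lamO A B) (.lamO A' B') := ⟨Red.lamO h1.1 h2.1, Normal.lamO h1.2 h2.2⟩

theorem appsO_concat (M : Obj) (N : List Obj) (P : Obj) :
    appsO M (N ++ [P]) = .appO (appsO M N) P := by simp [appsO]

theorem appsF_concat (A : Fam) (N : List Obj) (P : Obj) :
    appsF A (N ++ [P]) = .appF (appsF A N) P := by simp [appsF]

theorem appsO_rename (M : Obj) (N : List Obj) (r : ℕ → ℕ) :
    (appsO M N).rename r = appsO (M.rename r) (N.map (Exp.rename r)) := by
  induction N generalizing M with
  | nil => rfl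
  | cons P N ih => exact ih _

theorem appsO_subst (M : Obj) (N : List Obj) (s : ℕ → Obj) :
    (appsO M N).subst s = appsO (M.subst s) (N.map (Exp.subst s)) := by
  induction N generalizing M with
  | nil => rfl
  | cons P N ih => exact ih _

theorem appsF_rename (M : Fam) (N : List Obj) (r : ℕ → ℕ) :
    (appsF M N).rename r = appsF (M.rename r) (N.map (Exp.rename r)) := by
  induction N generalizing M with
  | nil => rfl
  | cons P N ih => exact ih _

theorem appsF_subst (M : Fam) (N : List Obj) (s : ℕ → Obj) :
    (appsF M N).subst s = appsF (M.subst s) (N.map (Exp.subst s)) := by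
  induction N generalizing M with
  | nil => rfl
  | cons P N ih => exact ih _

theorem appsO_var_ne_lamO (y : ℕ) (N : List Obj) (A : Fam) (M : Obj) :
    appsO (.var y) N ≠ .lamO A M := by
  induction N using List.reverseRecOn with
  | nil => simp [appsO]
  | append_singleton N P _ => simp [appsO_concat]

theorem appsO_var_inj {y z : ℕ} {N P : List Obj} (h : appsO (.var y) N = appsO (.var z) P) :
    y = z ∧ N = P := by
  induction N using List.reverseRecOn generalizing P with
  | nil =>
    cases P using List.reverseRecOn with
    | nil => simpa [appsO] using h
    | append_singleton P Q => simp [appsO_concat] at h; simp [appsO] at h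
  | append_singleton N Q ih =>
    cases P using List.reverseRecOn with
    | nil => simp [appsO_concat] at h; simp [appsO] at h
    | append_singleton P Q =>
      simp only [appsO_concat, Exp.appO.injEq] at h
      obtain ⟨rfl, rfl⟩ := ih h.1
      simp [h.2]

theorem appsF_tvar_inj {y z : ℕ} {N P : List Obj} (h : appsF (.tvar y) N = appsF (.tvar z) P) :
    y = z ∧ N = P := by
  induction N using List.reverseRecOn generalizing P with
  | nil =>
    cases P using List.reverseRecOn with
    | nil => simpa [appsF] using h
    | append_singleton P Q => simp [appsF_concat] at h; simp [appsF] at h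
  | append_singleton N Q ih =>
    cases P using List.reverseRecOn with
    | nil => simp [appsF_concat] at h; simp [appsF] at h
    | append_singleton P Q =>
      simp only [appsF_concat, Exp.appF.injEq] at h
      obtain ⟨rfl, rfl⟩ := ih h.1
      simp [h.2]

theorem forall₂_concat {α β : Type} {R : α → β → Prop} {l : List α} {l' : List β} {a : α} {b : β}
    (h : List.Forall₂ R l l') (hab : R a b) : List.Forall₂ R (l ++ [a]) (l' ++ [b]) :=
  List.rel_append h (.cons hab .nil)

theorem Red.appsO_var_inv {y : ℕ} {N : List Obj} {X : Obj} (h : Red (appsO (.var y) N) X) :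
    ∃ N', X = appsO (.var y) N' ∧ List.Forall₂ Red N N' := by
  induction N using List.reverseRecOn generalizing X with
  | nil => exact ⟨[], Normal.eq_of_red (fun _ h => by cases h) h, .nil⟩
  | append_singleton N P ih =>
    rw [appsO_concat] at h
    have : ∃ Q P', X = .appO Q P' ∧ Red (appsO (.var y) N) Q ∧ Red P P' := by
      induction h with
      | refl => exact ⟨_, _, rfl, .refl, .refl⟩
      | tail _ h ih' =>
        obtain ⟨Q, P', rfl, h1, h2⟩ := ih'
        cases h with
        -- Reducts of an applied variable are applied variables, so the function part never becomes
        -- an abstraction.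
        | betaO =>
          obtain ⟨N', h, _⟩ := ih h1
          exact absurd h.symm (appsO_var_ne_lamO _ _ _ _)
        | appO₁ h => exact ⟨_, _, rfl, h1.tail h, h2⟩
        | appO₂ h => exact ⟨_, _, rfl, h1, h2.tail h⟩
    obtain ⟨Q, P', rfl, h1, h2⟩ := this
    obtain ⟨N', rfl, h3⟩ := ih h1
    exact ⟨N' ++ [P'], (appsO_concat _ _ _).symm, forall₂_concat h3 h2⟩

theorem Normal.appsO_inv {M : Obj} {N : List Obj} (h : Normal (appsO M N)) :
    ∀ P ∈ N, Normal P := by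
  induction N using List.reverseRecOn with
  | nil => simp
  | append_singleton N Q ih =>
    rw [appsO_concat] at h
    intro P hP
    rw [List.mem_append, List.mem_singleton] at hP
    rcases hP with hP | rfl
    · exact ih (fun _ h' => h _ (.appO₁ h')) P hP
    · exact fun _ h' => h _ (.appO₂ h')

theorem Normal.appsO_var {y : ℕ} {N : List Obj} (h : ∀ P ∈ N, Normal P) :
    Normal (appsO (.var y) N) := by
  induction N using List.reverseRecOn with
  | nil => intro _ h; cases h
  | append_singleton N Q ih =>
    rw [appsO_concat]
    intro X hX
    generalize hY : appsO (.var y) N = Y at hX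
    cases hX with
    | betaO => exact appsO_var_ne_lamO _ _ _ _ hY
    | appO₁ hX => exact ih (fun P hP => h P (by simp [hP])) _ (hY ▸ hX)
    | appO₂ hX => exact h Q (by simp) _ hX

theorem Normal.appsF_tvar {u : ℕ} {N : List Obj} (h : ∀ P ∈ N, Normal P) :
    Normal (appsF (.tvar u) N) := by
  induction N using List.reverseRecOn with
  | nil => intro _ h; cases h
  | append_singleton N Q ih =>
    rw [appsF_concat]
    intro X hX
    generalize hY : appsF (.tvar u) N = Y at hX
    cases hX with
    | betaF =>
      cases N using List.reverseRecOn with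
      | nil => simp [appsF] at hY
      | append_singleton => simp [appsF_concat] at hY
    | appF₁ hX => exact ih (fun P hP => h P (by simp [hP])) _ (hY ▸ hX)
    | appF₂ hX => exact h Q (by simp) _ hX

theorem BetaNF.appsO_var_inv {y : ℕ} {N : List Obj} {X : Obj} (h : BetaNF (appsO (.var y) N) X) :
    ∃ N', X = appsO (.var y) N' ∧ List.Forall₂ BetaNF N N' := by
  obtain ⟨h1, h2⟩ := h
  obtain ⟨N', rfl, h3⟩ := Red.appsO_var_inv h1
  have h4 := Normal.appsO_inv h2
  refine ⟨N', rfl, ?_⟩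
  clear h1 h2
  induction h3 with
  | nil => exact .nil
  | cons h _ ih =>
    simp only [List.mem_cons, forall_eq_or_imp] at h4
    exact .cons ⟨h, h4.1⟩ (ih h4.2)

/-! ### Types built from applied type variables by products -/

/-- `IsAtom u A`: `A` is the type variable `u` applied to objects. -/
inductive IsAtom (u : ℕ) : Fam → Prop
  | tvar : IsAtom u (.tvar u)
  | app {A : Fam} {M : Obj} : IsAtom u A → IsAtom u (.appF A M)

theorem IsAtom.appsF {u : ℕ} {A : Fam} (h : IsAtom u A) (N : List Obj) :
    IsAtom u (appsF A N) := by
  induction N generalizing A with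
  | nil => exact h
  | cons P N ih => exact ih (.app h)

theorem isBase_iff {A : Fam} : IsBase A ↔ ∃ u, IsAtom u A := by
  constructor
  · rintro ⟨u, N, rfl⟩
    exact ⟨u, IsAtom.appsF .tvar N⟩
  · rintro ⟨u, h⟩
    induction h with
    | tvar => exact ⟨u, [], rfl⟩
    | @app A M _ ih =>
      obtain ⟨v, N, rfl⟩ := ih
      exact ⟨v, N ++ [M], (appsF_concat _ _ _).symm⟩

/-- Substitution acts on object variables only and cannot touch the head type variable. -/
theorem IsAtom.subst_iff {u : ℕ} {A : Fam} {s : ℕ → Obj} : IsAtom u (A.subst s) ↔ IsAtom u A := by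
  constructor
  · intro h
    generalize hB : A.subst s = B at h
    induction h generalizing A with
    | tvar => cases A <;> simp_all [Exp.subst]; exact .tvar
    | app _ ih => cases A <;> simp_all [Exp.subst]; exact .app (ih hB.1)
  · intro h
    induction h with
    | tvar => exact .tvar
    | app _ ih => exact .app ih

theorem IsAtom.step {u : ℕ} {A B : Fam} (h : IsAtom u A) (hs : Step A B) : IsAtom u B := by
  induction h generalizing B with
  | tvar => cases hs
  | app h ih =>
    cases hs with
    | betaF => cases h
    | appF₁ hs => exact .app (ih hs)
    | appF₂ => exact .app h

theorem IsAtom.unique {u v : ℕ} {A : Fam} (h : IsAtom u A) (h' : IsAtom v A) : u = v := by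
  induction h with
  | tvar => cases h'; rfl
  | app _ ih => cases h' with | app h' => exact ih h'

/-- Types and kinds `Πx₁:A₁.…Πxₙ:Aₙ.e` where `e` is `type` or an applied type variable belonging
to `U`, the `A`s being of this form too. -/
inductive Skel (U : Set ℕ) : {c : Cat} → Exp c → Prop
  | type : Skel U .type
  | base {u : ℕ} {A : Fam} : u ∈ U → IsAtom u A → Skel U A
  | piF {A B : Fam} : Skel U A → Skel U B → Skel U (.piF A B)
  | piK {A : Fam} {K : Kind} : Skel U A → Skel U K → Skel U (.piK A K)

theorem Skel.mono {U V : Set ℕ} (hUV : U ⊆ V) {e : Exp c} (h : Skel U e) : Skel V e := by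
  induction h with
  | type => exact .type
  | base h h' => exact .base (hUV h) h'
  | piF _ _ h1 h2 => exact .piF h1 h2
  | piK _ _ h1 h2 => exact .piK h1 h2

theorem Skel.subst {U : Set ℕ} {e : Exp c} (h : Skel U e) (s : ℕ → Obj) : Skel U (e.subst s) := by
  induction h generalizing s with
  | type => exact .type
  | base h h' => exact .base h (IsAtom.subst_iff.2 h')
  | piF _ _ h1 h2 => exact .piF (h1 _) (h2 _)
  | piK _ _ h1 h2 => exact .piK (h1 _) (h2 _)

theorem Skel.rename {U : Set ℕ} {e : Exp c} (h : Skel U e) (r : ℕ → ℕ) :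
    Skel U (e.rename r) := by
  rw [← subst_ren]; exact h.subst _

theorem Skel.step {U : Set ℕ} {e e' : Exp c} (h : Skel U e) (hs : Step e e') : Skel U e' := by
  induction h with
  | type => cases hs
  | base h h' => exact .base h (h'.step hs)
  | piF a b h1 h2 =>
    cases hs with
    | piF₁ hs => exact .piF (h1 hs) b
    | piF₂ hs => exact .piF a (h2 hs)
  | piK a b h1 h2 =>
    cases hs with
    | piK₁ hs => exact .piK (h1 hs) b
    | piK₂ hs => exact .piK a (h2 hs)

theorem Skel.red {U : Set ℕ} {e e' : Exp c} (h : Skel U e) (hs : Red e e') : Skel U e' := by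
  induction hs with
  | refl => exact h
  | tail _ h' ih => exact ih.step h'

theorem Skel.piF_inv {U : Set ℕ} {A B : Fam} (h : Skel U (Exp.piF A B)) : Skel U A ∧ Skel U B := by
  cases h with
  | base _ h => cases h
  | piF h1 h2 => exact ⟨h1, h2⟩

/-! ### Eta-expansion -/

theorem etaRen_rename (e : Exp c) (r s : ℕ → ℕ) (N : Obj) :
    etaRen (e.rename s) r N = etaRen e (fun x => r (s x)) N := by
  induction e generalizing r s N with
  | piF C D h1 h2 =>
    simp only [Exp.rename, etaRen, rename_rename, h1, h2, upRen_comp]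
  | _ => rfl

/-- Recovers the textbook recursion. The renaming carried by `etaRen` only serves to make its
recursion structural, and can be absorbed into the type. -/
theorem eta_piF (C D : Fam) (N : Obj) :
    eta (.piF C D) N = .lamO C (eta D (.appO N.shift (eta C.shift (.var 0)))) := by
  have h1 : upRen (id : ℕ → ℕ) = id := upRen_id
  have h2 : C.rename (id : ℕ → ℕ) = C := rename_id C
  simp only [eta, Exp.shift, etaRen, etaRen_rename, h1, h2]
  rfl

theorem eta_of_not_piF {A : Fam} (h : ∀ C D, A ≠ .piF C D) (N : Obj) : eta A N = N := by
  cases A with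
  | piF C D => exact absurd rfl (h C D)
  | _ => rfl

/-- The number of products occurring hereditarily in domains and codomains of a type. -/
def piCount : {c : Cat} → Exp c → ℕ
  | _, .piF C D => piCount C + piCount D + 1
  | _, _ => 0

theorem piCount_subst (A : Exp c) (s : ℕ → Obj) (hc : c = .fam) :
    piCount (A.subst s) = piCount A := by
  induction A generalizing s with
  | piF C D h1 h2 => simp [Exp.subst, piCount, h1, h2]
  | tvar | appF | lamF => rfl
  | _ => cases hc

theorem piCount_rename (A : Fam) (r : ℕ → ℕ) : piCount (A.rename r) = piCount A := by
  rw [← subst_ren, piCount_subst _ _ rfl]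

theorem eta_subst (A : Fam) (N : Obj) (s : ℕ → Obj) :
    (eta A N).subst s = eta (A.subst s) (N.subst s) := by
  induction hn : piCount A using Nat.strong_induction_on generalizing A N s with
  | _ n ih =>
    cases A with
    | piF C D =>
      simp only [piCount] at hn
      simp only [eta_piF, Exp.subst]
      rw [ih (piCount D) (by omega) _ _ _ rfl]
      simp only [Exp.subst, shift_subst_up]
      rw [ih (piCount C) (by omega) C.shift _ _ (piCount_rename C _), shift_subst_up]
      rfl
    | _ => rfl

theorem eta_rename (A : Fam) (N : Obj) (r : ℕ → ℕ) :
    (eta A N).rename r = eta (A.rename r) (N.rename r) := by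
  simp only [← subst_ren, eta_subst]

theorem IsAtom.not_piF {u : ℕ} {A : Fam} (h : IsAtom u A) (C D : Fam) : A ≠ .piF C D := by
  rintro rfl; cases h

theorem IsBase.not_piF {A : Fam} (h : IsBase A) (C D : Fam) : A ≠ .piF C D := by
  obtain ⟨u, h⟩ := isBase_iff.1 h
  exact h.not_piF C D

theorem IsAtom.red {u : ℕ} {A B : Fam} (h : IsAtom u A) (hs : Red A B) : IsAtom u B := by
  induction hs with
  | refl => exact h
  | tail _ h' ih => exact ih.step h'

theorem IsBase.red {A B : Fam} (h : IsBase A) (hs : Red A B) : IsBase B := by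
  obtain ⟨u, h⟩ := isBase_iff.1 h
  exact isBase_iff.2 ⟨u, h.red hs⟩

theorem IsBase.subst_iff {A : Fam} {s : ℕ → Obj} : IsBase (A.subst s) ↔ IsBase A := by
  simp only [isBase_iff, IsAtom.subst_iff]

theorem IsBase.rename_iff {A : Fam} {r : ℕ → ℕ} : IsBase (A.rename r) ↔ IsBase A := by
  rw [← subst_ren, IsBase.subst_iff]

/-- A redex of families could contract to a product and change the count. In a skeleton the atoms
stay atoms and products reduce componentwise. -/
theorem Skel.piCount_red {U : Set ℕ} {A B : Fam} (h : Skel U A) (hr : Red A B) :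
    piCount B = piCount A := by
  induction hn : piCount A using Nat.strong_induction_on generalizing A B with
  | _ n ih =>
    cases h with
    | @base u _ hu h =>
      have h' := h.red hr
      subst hn
      cases h <;> cases h' <;> rfl
    | piF h1 h2 =>
      obtain ⟨_, _, rfl, h3, h4⟩ := hr.piF_inv
      simp only [piCount] at hn ⊢
      rw [ih _ (by omega) h1 h3 rfl, ih _ (by omega) h2 h4 rfl]
      exact hn

/-- Convertible skeletons have the same product structure: a common reduct cannot be both an atom
and a product. The two expansions therefore unfold in step. -/
theorem Skel.eta_conv {U V : Set ℕ} {A B : Fam} (hA : Skel U A) (hB : Skel V B) (h : Conv A B)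
    {M N : Obj} (hMN : Conv M N) : Conv (eta A M) (eta B N) := by
  induction hn : piCount A using Nat.strong_induction_on generalizing A B M N with
  | _ n ih =>
    cases hA with
    | base _ hA =>
      cases hB with
      | base _ hB => rwa [eta_of_not_piF hA.not_piF, eta_of_not_piF hB.not_piF]
      | piF =>
        obtain ⟨d, h1, h2⟩ := h
        obtain ⟨_, _, rfl, -⟩ := h2.piF_inv
        exact absurd rfl ((hA.red h1).not_piF _ _)
    | @piF A₁ A₂ h1 h2 =>
      cases hB with
      | base _ hB =>
        obtain ⟨d, h1, h2⟩ := h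
        obtain ⟨_, _, rfl, -⟩ := h1.piF_inv
        exact absurd rfl ((hB.red h2).not_piF _ _)
      | piF h3 h4 =>
        obtain ⟨h5, h6⟩ := h.piF_inj
        simp only [piCount] at hn
        simp only [eta_piF]
        refine h5.lamO (ih (piCount A₂) (by omega) h2 h4 h6 ((hMN.rename _).appO ?_) rfl)
        exact ih (piCount A₁) (by omega) (h1.rename _) (h3.rename _) (h5.rename _) (.refl _)
          (piCount_rename _ _)

/-! ### Contexts -/

theorem HasObj.unique {Γ : Ctx} {x : ℕ} {A B : Fam} (h : HasObj Γ x A) (h' : HasObj Γ x B) :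
    A = B := by
  induction h generalizing B with
  | here => cases h'; rfl
  | skipObj _ ih => cases h' with | skipObj h' => rw [ih h']
  | skipFam _ ih => cases h' with | skipFam h' => exact ih h'

theorem hasObj_zero {Γ : Ctx} {A B : Fam} (h : HasObj (.obj A :: Γ) 0 B) : B = A.shift :=
  h.unique .here

theorem hasObj_succ {Γ : Ctx} {A B : Fam} {x : ℕ} (h : HasObj (.obj A :: Γ) (x + 1) B) :
    ∃ B', HasObj Γ x B' ∧ B = B'.shift := by
  cases h with
  | skipObj h => exact ⟨_, h, rfl⟩

theorem hasFam_obj {Γ : Ctx} {A : Fam} {u : ℕ} {K : Kind} (h : HasFam (.obj A :: Γ) u K) :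
    ∃ K', HasFam Γ u K' ∧ K = K'.shift := by
  cases h with
  | skipObj h => exact ⟨_, h, rfl⟩

/-- The type variables declared in a context. -/
def famDom (Γ : Ctx) : Set ℕ := {u | ∃ K, HasFam Γ u K}

theorem famDom_obj (Γ : Ctx) (A : Fam) : famDom (.obj A :: Γ) = famDom Γ := by
  ext u
  constructor
  · rintro ⟨K, h⟩
    obtain ⟨K', h, -⟩ := hasFam_obj h
    exact ⟨K', h⟩
  · rintro ⟨K, h⟩
    exact ⟨_, .skipObj h⟩

theorem famDom_subset_fam (Γ : Ctx) (u : ℕ) (K : Kind) : famDom Γ ⊆ famDom (.fam u K :: Γ) := by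
  rintro v ⟨K, h⟩
  exact ⟨_, .skipFam h⟩

/-! ### The backchaining premises as a relation -/

/-- The possible targets of a product in the backchaining rules. -/
def IsTarget : {c : Cat} → Exp c → Prop
  | .kind, K => K = .type
  | .fam, A => IsBase A
  | .obj, _ => False

theorem IsTarget.rename {e : Exp c} (h : IsTarget e) (r : ℕ → ℕ) : IsTarget (e.rename r) := by
  cases c with
  | kind => cases h; rfl
  | fam => exact IsBase.rename_iff.2 h
  | obj => exact h

theorem IsTarget.of_rename {e : Exp c} {r : ℕ → ℕ} (h : IsTarget (e.rename r)) :
    IsTarget e := by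
  cases c with
  | kind => cases e with
    | type => rfl
    | piK => cases h
  | fam => exact IsBase.rename_iff.1 h
  | obj => exact h

/-- `Spine P s e N R`: the expression `e[s]` is an iterated product that can be applied to the
arguments `N`, each of which has the normalised domain type according to `P`, and `R` is the
normalised result. -/
inductive Spine (P : Obj → Fam → Prop) :
    {c : Cat} → (ℕ → Obj) → Exp c → List Obj → Exp c → Prop
  | nil {c : Cat} {s : ℕ → Obj} {e R : Exp c} :
      IsTarget e → BetaNF (e.subst s) R → Spine P s e [] R
  | consF {s : ℕ → Obj} {B B' S R : Fam} {N : Obj} {Ns : List Obj} :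
      BetaNF (B.subst s) B' → P N B' → Spine P (scons N s) S Ns R →
      Spine P s (.piF B S) (N :: Ns) R
  | consK {s : ℕ → Obj} {B B' : Fam} {S R : Kind} {N : Obj} {Ns : List Obj} :
      BetaNF (B.subst s) B' → P N B' → Spine P (scons N s) S Ns R →
      Spine P s (.piK B S) (N :: Ns) R

/-- The substitution `s` extended by values for further, innermost variables. -/
def extend (s : ℕ → Obj) : List Obj → ℕ → Obj
  | [] => s
  | N :: Ns => extend (scons N s) Ns

theorem extend_apply (s : ℕ → Obj) (N : List Obj) (x : ℕ) :
    extend s N x = (N.reverse[x]?).getD (s (x - N.length)) := by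
  induction N generalizing s with
  | nil => simp [extend]
  | cons P N ih =>
    rw [extend, ih, List.reverse_cons, List.getElem?_append]
    by_cases hx : x < N.length
    · simp [hx]
    · simp only [List.length_reverse, hx, if_false, List.length_cons]
      obtain ⟨m, rfl⟩ := Nat.exists_eq_add_of_le (not_lt.1 hx)
      cases m with
      | zero => simp
      | succ m =>
        simp [show N.length + (m + 1) - N.length = m + 1 by omega,
          show N.length + (m + 1) - (N.length + 1) = m by omega]

theorem inst_eq_extend (N : List Obj) : inst N = extend .var N := by
  funext x; rw [extend_apply]; rfl

theorem spine_pisF {P : Obj → Fam → Prop} {B : List Fam} {A A' : Fam} {N : List Obj}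
    {B' : ℕ → Fam} {s : ℕ → Obj} (hA : IsBase A) (hlen : N.length = B.length)
    (hB : ∀ k Bk, B[k]? = some Bk → BetaNF (Bk.subst (extend s (N.take k))) (B' k))
    (hN : ∀ k Nk, N[k]? = some Nk → P Nk (B' k)) (hA' : BetaNF (A.subst (extend s N)) A') :
    Spine P s (pisF B A) N A' := by
  induction B generalizing N s B' with
  | nil =>
    obtain rfl := List.length_eq_zero_iff.1 hlen
    exact .nil hA hA'
  | cons C B ih =>
    cases N with
    | nil => simp at hlen
    | cons Q N =>
      refine .consF (hB 0 C rfl) (hN 0 Q rfl) (ih (B' := fun k => B' (k + 1)) ?_ ?_ ?_ hA')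
      · simpa using hlen
      · intro k Bk hk
        exact hB (k + 1) Bk hk
      · intro k Nk hk
        exact hN (k + 1) Nk hk

theorem spine_pisK {P : Obj → Fam → Prop} {B : List Fam} {N : List Obj}
    {B' : ℕ → Fam} {s : ℕ → Obj} (hlen : N.length = B.length)
    (hB : ∀ k Bk, B[k]? = some Bk → BetaNF (Bk.subst (extend s (N.take k))) (B' k))
    (hN : ∀ k Nk, N[k]? = some Nk → P Nk (B' k)) :
    Spine P s (pisK B .type) N .type := by
  induction B generalizing N s B' with
  | nil =>
    obtain rfl := List.length_eq_zero_iff.1 hlen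
    exact .nil rfl ⟨.refl, fun _ h => by cases h⟩
  | cons C B ih =>
    cases N with
    | nil => simp at hlen
    | cons Q N =>
      refine .consK (hB 0 C rfl) (hN 0 Q rfl) (ih (B' := fun k => B' (k + 1)) ?_ ?_ ?_)
      · simpa using hlen
      · intro k Bk hk
        exact hB (k + 1) Bk hk
      · intro k Nk hk
        exact hN (k + 1) Nk hk

theorem Spine.exists_pisF {P : Obj → Fam → Prop} {S R : Fam} {N : List Obj} {s : ℕ → Obj}
    (h : Spine P s S N R) :
    ∃ (B : List Fam) (A : Fam) (B' : ℕ → Fam), S = pisF B A ∧ IsBase A ∧ N.length = B.length ∧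
      (∀ k Bk, B[k]? = some Bk → BetaNF (Bk.subst (extend s (N.take k))) (B' k)) ∧
      (∀ k Nk, N[k]? = some Nk → P Nk (B' k)) ∧ BetaNF (A.subst (extend s N)) R := by
  induction N generalizing S s with
  | nil =>
    cases h with
    -- There are no arguments, so the sequence of normalised domain types is arbitrary.
    | nil h1 h2 => exact ⟨[], S, fun _ => S, rfl, h1, rfl, by simp, by simp, h2⟩
  | cons Q N ih =>
    cases h with
    | @consF _ C C' S _ _ _ h1 h2 h3 =>
      obtain ⟨B, A, B', rfl, hA, hlen, hB, hN, hR⟩ := ih h3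
      refine ⟨C :: B, A, fun k => Nat.casesOn k C' B', rfl, hA, by simp [hlen], ?_, ?_, hR⟩
      · intro k Bk hk
        cases k with
        | zero => cases hk; exact h1
        | succ k => exact hB k Bk hk
      · intro k Nk hk
        cases k with
        | zero => cases hk; exact h2
        | succ k => exact hN k Nk hk

theorem Spine.exists_pisK {P : Obj → Fam → Prop} {S R : Kind} {N : List Obj} {s : ℕ → Obj}
    (h : Spine P s S N R) :
    ∃ (B : List Fam) (B' : ℕ → Fam), S = pisK B .type ∧ N.length = B.length ∧
      (∀ k Bk, B[k]? = some Bk → BetaNF (Bk.subst (extend s (N.take k))) (B' k)) ∧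
      (∀ k Nk, N[k]? = some Nk → P Nk (B' k)) := by
  induction N generalizing S s with
  | nil =>
    cases h with
    | nil h1 h2 => exact ⟨[], fun _ => .tvar 0, h1, rfl, by simp, by simp⟩
  | cons Q N ih =>
    cases h with
    | @consK _ C C' S _ _ _ h1 h2 h3 =>
      obtain ⟨B, B', rfl, hlen, hB, hN⟩ := ih h3
      refine ⟨C :: B, fun k => Nat.casesOn k C' B', rfl, by simp [hlen], ?_, ?_⟩
      · intro k Bk hk
        cases k with
        | zero => cases hk; exact h1
        | succ k => exact hB k Bk hk
      · intro k Nk hk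
        cases k with
        | zero => cases hk; exact h2
        | succ k => exact hN k Nk hk

theorem Spine.normal {P : Obj → Fam → Prop} {s : ℕ → Obj} {e R : Exp c} {N : List Obj}
    (h : Spine P s e N R) : Normal R := by
  induction h with
  | nil _ h => exact h.2
  | consF _ _ _ ih => exact ih
  | consK _ _ _ ih => exact ih

theorem Spine.forall_mem {P : Obj → Fam → Prop} {s : ℕ → Obj} {e R : Exp c} {N : List Obj}
    (h : Spine P s e N R) : ∀ M ∈ N, ∃ B, P M B := by
  induction h with
  | nil => simp
  | consF _ h _ ih => simpa using ⟨⟨_, h⟩, ih⟩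
  | consK _ h _ ih => simpa using ⟨⟨_, h⟩, ih⟩

theorem Spine.isBase {P : Obj → Fam → Prop} {s : ℕ → Obj} {S R : Fam} {N : List Obj}
    (h : Spine P s S N R) : IsBase R := by
  induction N generalizing S s with
  | nil => cases h with | nil h1 h2 => exact (IsBase.subst_iff.2 h1).red h2.1
  | cons Q N ih => cases h with | consF _ _ h => exact ih h

/-! ### Rules of canonical LF in terms of spines -/

/-- The induction principle for canonical LF with the backchaining premises given by spines. -/
theorem Derivable.spine_induction {motive : Assertion → Prop}
    (nullCtx : motive (.ctx []))
    (kindCtx : ∀ {Γ u K}, Derivable (.kind Γ K) → Derivable (.ctx Γ) → (∀ L, ¬ HasFam Γ u L) →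
      motive (.kind Γ K) → motive (.ctx Γ) → motive (.ctx (.fam u K :: Γ)))
    (typeCtx : ∀ {Γ A}, Derivable (.fam Γ A .type) → Derivable (.ctx Γ) →
      motive (.fam Γ A .type) → motive (.ctx Γ) → motive (.ctx (.obj A :: Γ)))
    (typeKind : ∀ {Γ}, Derivable (.ctx Γ) → motive (.ctx Γ) → motive (.kind Γ .type))
    (piKind : ∀ {Γ A K}, Derivable (.fam Γ A .type) → Derivable (.kind (.obj A :: Γ) K) →
      motive (.fam Γ A .type) → motive (.kind (.obj A :: Γ) K) → motive (.kind Γ (.piK A K)))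
    (piFam : ∀ {Γ A B}, Derivable (.fam Γ A .type) → Derivable (.fam (.obj A :: Γ) B .type) →
      motive (.fam Γ A .type) → motive (.fam (.obj A :: Γ) B .type) →
      motive (.fam Γ (.piF A B) .type))
    (absFam : ∀ {Γ A B K}, Derivable (.fam Γ A .type) → Derivable (.fam (.obj A :: Γ) B K) →
      motive (.fam Γ A .type) → motive (.fam (.obj A :: Γ) B K) →
      motive (.fam Γ (.lamF A B) (.piK A K)))
    (absObj : ∀ {Γ A B M}, Derivable (.fam Γ A .type) → Derivable (.obj (.obj A :: Γ) M B) →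
      motive (.fam Γ A .type) → motive (.obj (.obj A :: Γ) M B) →
      motive (.obj Γ (.lamO A M) (.piF A B)))
    (backchainFam : ∀ {Γ u K N}, Derivable (.ctx Γ) → HasFam Γ u K →
      Spine (fun M A => Derivable (.obj Γ M A) ∧ motive (.obj Γ M A)) .var K N .type →
      motive (.ctx Γ) → motive (.fam Γ (appsF (.tvar u) N) .type))
    (backchainObj : ∀ {Γ y S N A}, Derivable (.ctx Γ) → HasObj Γ y S →
      Spine (fun M A => Derivable (.obj Γ M A) ∧ motive (.obj Γ M A)) .var S N A →
      motive (.ctx Γ) → motive (.obj Γ (appsO (.var y) N) A))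
    {J : Assertion} (h : Derivable J) : motive J := by
  induction h with
  | nullCtx => exact nullCtx
  | kindCtx h1 h2 h3 ih1 ih2 => exact kindCtx h1 h2 h3 ih1 ih2
  | typeCtx h1 h2 ih1 ih2 => exact typeCtx h1 h2 ih1 ih2
  | typeKind h ih => exact typeKind h ih
  | piKind h1 h2 ih1 ih2 => exact piKind h1 h2 ih1 ih2
  | piFam h1 h2 ih1 ih2 => exact piFam h1 h2 ih1 ih2
  | absFam h1 h2 ih1 ih2 => exact absFam h1 h2 ih1 ih2
  | absObj h1 h2 ih1 ih2 => exact absObj h1 h2 ih1 ih2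
  | backchainFam h1 h2 h3 h4 h5 ih1 ih5 =>
    refine backchainFam h1 h2 (spine_pisK h3 ?_ fun k Nk hk => ⟨h5 k Nk hk, ih5 k Nk hk⟩) ih1
    simpa only [← inst_eq_extend] using h4
  | backchainObj h1 h2 h3 h4 h5 h6 h7 ih1 ih6 =>
    refine backchainObj h1 h2
      (spine_pisF h3 h4 ?_ (fun k Nk hk => ⟨h6 k Nk hk, ih6 k Nk hk⟩) ?_) ih1
    · simpa only [← inst_eq_extend] using h5
    · simpa only [← inst_eq_extend] using h7

theorem Derivable.appsO_spine {Γ : Ctx} {y : ℕ} {S A : Fam} {N : List Obj}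
    (hΓ : Derivable (.ctx Γ)) (hy : HasObj Γ y S)
    (h : Spine (fun M A => Derivable (.obj Γ M A)) .var S N A) :
    Derivable (.obj Γ (appsO (.var y) N) A) := by
  obtain ⟨B, A, B', rfl, hA, hlen, hB, hN, hR⟩ := h.exists_pisF
  simp only [← inst_eq_extend] at hB hR
  exact .backchainObj hΓ hy hA hlen hB hN hR

theorem Derivable.appsF_spine {Γ : Ctx} {u : ℕ} {K : Kind} {N : List Obj}
    (hΓ : Derivable (.ctx Γ)) (hu : HasFam Γ u K)
    (h : Spine (fun M A => Derivable (.obj Γ M A)) .var K N .type) :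
    Derivable (.fam Γ (appsF (.tvar u) N) .type) := by
  obtain ⟨B, B', rfl, hlen, hB, hN⟩ := h.exists_pisK
  simp only [← inst_eq_extend] at hB
  exact .backchainFam hΓ hu hlen hB hN

theorem Derivable.lamO_inv {Γ : Ctx} {C T : Fam} {M : Obj}
    (h : Derivable (.obj Γ (.lamO C M) T)) :
    ∃ B, T = .piF C B ∧ Derivable (.fam Γ C .type) ∧ Derivable (.obj (.obj C :: Γ) M B) := by
  generalize hQ : Exp.lamO C M = Q at h
  cases h with
  | absObj h1 h2 => cases hQ; exact ⟨_, rfl, h1, h2⟩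
  | backchainObj => exact absurd hQ.symm (appsO_var_ne_lamO _ _ _ _)

theorem Derivable.appsO_inv {Γ : Ctx} {y : ℕ} {N : List Obj} {A : Fam}
    (h : Derivable (.obj Γ (appsO (.var y) N) A)) :
    ∃ S, HasObj Γ y S ∧ Spine (fun M A => Derivable (.obj Γ M A)) .var S N A := by
  generalize hQ : appsO (.var y) N = Q at h
  cases h with
  | absObj => exact absurd hQ (appsO_var_ne_lamO _ _ _ _)
  | backchainObj h1 h2 h3 h4 h5 h6 h7 =>
    obtain ⟨rfl, rfl⟩ := appsO_var_inj hQ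
    refine ⟨_, h2, spine_pisF h3 h4 ?_ h6 ?_⟩
    · simpa only [← inst_eq_extend] using h5
    · simpa only [← inst_eq_extend] using h7

/-- The context of an assertion. -/
def Assertion.context : Assertion → Ctx
  | .ctx Γ => Γ
  | .kind Γ _ => Γ
  | .fam Γ _ _ => Γ
  | .obj Γ _ _ => Γ

theorem Derivable.obj_cons_inv {Γ : Ctx} {A : Fam} (h : Derivable (.ctx (.obj A :: Γ))) :
    Derivable (.fam Γ A .type) ∧ Derivable (.ctx Γ) := by
  cases h with | typeCtx h1 h2 => exact ⟨h1, h2⟩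

theorem Derivable.fam_cons_inv {Γ : Ctx} {u : ℕ} {K : Kind}
    (h : Derivable (.ctx (.fam u K :: Γ))) :
    Derivable (.kind Γ K) ∧ Derivable (.ctx Γ) ∧ ∀ L, ¬ HasFam Γ u L := by
  cases h with | kindCtx h1 h2 h3 => exact ⟨h1, h2, h3⟩

theorem Derivable.ctx_tail {d : Decl} {Γ : Ctx} (h : Derivable (.ctx (d :: Γ))) :
    Derivable (.ctx Γ) := by
  cases d with
  | obj A => exact h.obj_cons_inv.2
  | fam u K => exact h.fam_cons_inv.2.1

theorem Derivable.ctx_of_append {Δ Γ : Ctx} (h : Derivable (.ctx (Δ ++ Γ))) :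
    Derivable (.ctx Γ) := by
  induction Δ with
  | nil => exact h
  | cons d Δ ih => exact ih (Derivable.ctx_tail h)

theorem Derivable.ctx {J : Assertion} (h : Derivable J) : Derivable (.ctx J.context) := by
  induction h with
  | nullCtx => exact .nullCtx
  | kindCtx h1 h2 h3 => exact .kindCtx h1 h2 h3
  | typeCtx h1 h2 => exact .typeCtx h1 h2
  | typeKind h => exact h
  | piKind _ _ ih => exact ih
  | piFam _ _ ih => exact ih
  | absFam _ _ ih => exact ih
  | absObj _ _ ih => exact ih
  | backchainFam h => exact h
  | backchainObj h => exact h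

/-- The expressions typed by an assertion, and their types, are normal. -/
def Assertion.AllNormal : Assertion → Prop
  | .ctx _ => True
  | .kind _ K => Normal K
  | .fam _ A _ => Normal A
  | .obj _ M A => Normal M ∧ Normal A

/-- Backchaining applies variables to normal arguments and returns a normalised type; the other
rules put no abstraction in function position. -/
theorem Derivable.allNormal {J : Assertion} (h : Derivable J) : J.AllNormal := by
  refine h.spine_induction (motive := Assertion.AllNormal) trivial (fun _ _ _ _ _ => trivial)
    (fun _ _ _ _ => trivial) ?_ ?_ ?_ ?_ ?_ ?_ ?_
  · intro _ _ _ _ h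
    cases h
  · intro _ _ _ _ _ h1 h2 _ h
    cases h with
    | piK₁ h => exact h1 _ h
    | piK₂ h => exact h2 _ h
  · intro _ _ _ _ _ h1 h2
    exact Normal.piF h1 h2
  · intro _ _ _ _ _ _ h1 h2 _ h
    cases h with
    | lamF₁ h => exact h1 _ h
    | lamF₂ h => exact h2 _ h
  · intro _ _ _ _ _ _ h1 h2
    exact ⟨Normal.lamO h1 h2.1, Normal.piF h1 h2.2⟩
  · intro _ _ _ _ _ _ h _
    refine Normal.appsF_tvar fun P hP => ?_
    obtain ⟨B, h⟩ := h.forall_mem P hP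
    exact h.2.1
  · intro _ _ _ _ _ _ _ h _
    refine ⟨Normal.appsO_var fun P hP => ?_, h.normal⟩
    obtain ⟨B, h⟩ := h.forall_mem P hP
    exact h.2.1

/-- The declared types and kinds, and the types and kinds formed by an assertion, are products of
atoms over declared type variables. -/
def Assertion.AllSkel : Assertion → Prop
  | .ctx Γ => (∀ x A, HasObj Γ x A → Skel (famDom Γ) A) ∧ ∀ u K, HasFam Γ u K → Skel (famDom Γ) K
  | .kind Γ K => Skel (famDom Γ) K
  | .fam Γ A K => K = .type → Skel (famDom Γ) A
  | .obj _ _ _ => True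

/-- The rule for abstracted families is the only one that leaves the class of skeletons, and its
result has a product kind, never `type`. -/
theorem Derivable.allSkel {J : Assertion} (h : Derivable J) : J.AllSkel := by
  induction h with
  | nullCtx => exact ⟨fun _ _ h => (by cases h), fun _ _ h => (by cases h)⟩
  | @kindCtx Γ u K _ _ _ h1 h2 =>
    have hsub := famDom_subset_fam Γ u K
    constructor
    · intro x A h
      cases h with | skipFam h => exact (h2.1 _ _ h).mono hsub
    · intro v L h
      cases h with
      | here => exact h1.mono hsub
      | skipFam h => exact (h2.2 _ _ h).mono hsub
  | @typeCtx Γ A _ _ h1 h2 =>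
    constructor
    · intro x B h
      rw [famDom_obj]
      cases h with
      | here => exact (h1 rfl).rename _
      | skipObj h => exact (h2.1 _ _ h).rename _
    · intro v L h
      rw [famDom_obj]
      cases h with
      | skipObj h => exact (h2.2 _ _ h).rename _
  | typeKind => exact .type
  | piKind _ _ h1 h2 =>
    simp only [Assertion.AllSkel, famDom_obj] at h1 h2
    exact .piK (h1 trivial) h2
  | piFam _ _ h1 h2 =>
    simp only [Assertion.AllSkel, famDom_obj] at h1 h2
    exact fun _ => .piF (h1 trivial) (h2 trivial)
  | absFam => intro h; cases h
  | absObj => trivial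
  | backchainFam _ hu => exact fun _ => .base ⟨_, hu⟩ (IsAtom.appsF .tvar _)
  | backchainObj => trivial

theorem Derivable.skel {Γ : Ctx} (h : Derivable (.ctx Γ)) {x : ℕ} {A : Fam} (hx : HasObj Γ x A) :
    Skel (famDom Γ) A := h.allSkel.1 x A hx

/-! ### Substituting eta-expanded variables into canonical expressions -/

/-- `s` maps every variable `x` declared in `Γ` to the variable `r x`, possibly eta-expanded at
the declared type of `x` when the size of that type satisfies `p`. -/
def EtaSubst (p : ℕ → Prop) (Γ : Ctx) (s : ℕ → Obj) (r : ℕ → ℕ) : Prop :=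
  ∀ x A, HasObj Γ x A →
    s x = .var (r x) ∨ (p (piCount A) ∧ s x = eta (A.rename r) (.var (r x)))

theorem EtaSubst.up {p : ℕ → Prop} {Γ : Ctx} {s : ℕ → Obj} {r : ℕ → ℕ} (h : EtaSubst p Γ s r)
    (A : Fam) : EtaSubst p (.obj A :: Γ) (up s) (upRen r) := by
  intro x B hx
  cases x with
  | zero => exact .inl rfl
  | succ x =>
    obtain ⟨B, hx', rfl⟩ := hasObj_succ hx
    rcases h x B hx' with h | ⟨h1, h2⟩
    · left; rw [up_succ, h]; rfl
    · right
      rw [Exp.shift, piCount_rename, ← Exp.shift, shift_rename_upRen, up_succ, h2]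
      exact ⟨h1, eta_rename _ _ _⟩

theorem EtaSubst.scons {p : ℕ → Prop} {Γ : Ctx} {s : ℕ → Obj} {r : ℕ → ℕ}
    (h : EtaSubst p Γ s r) {B : Fam} (hB : p (piCount B)) (y : ℕ) :
    EtaSubst p (.obj B :: Γ) (scons (eta (B.rename r) (.var y)) s) (scons y r) := by
  intro x A hx
  cases x with
  | zero =>
    obtain rfl := hasObj_zero hx
    right
    rw [Exp.shift, piCount_rename, ← Exp.shift, shift_rename_scons]
    exact ⟨hB, rfl⟩
  | succ x =>
    obtain ⟨A, hx', rfl⟩ := hasObj_succ hx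
    rw [Exp.shift, piCount_rename, ← Exp.shift, shift_rename_scons]
    exact h x A hx'

/-- Applying the expansion of `M` to a full spine contracts one redex per argument and leaves `M`
applied to the arguments expanded at their domain types. Those domains are smaller than `S`, so `hP`
removes the expansions; at the base target nothing is left to expand. -/
theorem Spine.eta_head {P : Obj → Fam → Prop} {U : Set ℕ} {k : ℕ}
    (hP : ∀ N B, P N B → piCount B < k → Conv (eta B N) N) {s : ℕ → Obj} {S R : Fam}
    {N : List Obj} (h : Spine P s S N R) (hS : Skel U S) (hk : piCount S ≤ k) (M : Obj) :
    Conv (appsO (eta (S.subst s) M) N) (appsO M N) := by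
  induction N generalizing S s M with
  | nil =>
    cases h with
    | nil h1 _ =>
      rw [eta_of_not_piF (IsBase.not_piF (IsBase.subst_iff.2 h1))]
      exact .refl _
  | cons Q N ih =>
    cases h with
    | @consF _ B B' S _ _ _ h1 h2 h3 =>
      obtain ⟨hB, hS⟩ := hS.piF_inv
      simp only [piCount] at hk
      have hB' : Skel U B' := (hB.subst s).red h1.1
      have hcount : piCount B' = piCount B := by
        rw [(hB.subst s).piCount_red h1.1, piCount_subst _ _ rfl]
      refine Conv.trans (Conv.appsO (N := N) (N' := N) ?_
        (List.forall₂_same.2 fun _ _ => Conv.refl _)) (ih h3 hS (by omega) (.appO M Q))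
      simp only [Exp.subst, eta_piF]
      refine (conv_betaO _ _ _).trans ?_
      rw [eta_subst, subst_up_scons]
      refine (hS.subst _).eta_conv (hS.subst _) (.refl _) ?_
      simp only [Exp.subst, eta_subst, shift_subst_scons, subst_var, scons_zero]
      refine Conv.appO (.refl _) (Conv.trans ?_ (hP _ _ h2 (by omega)))
      exact (hB.subst s).eta_conv hB' h1.conv (.refl _)

/-- The instances of an assertion's subject under an eta-expanding substitution and under the
underlying renaming are convertible. -/
def Assertion.EtaStable (p : ℕ → Prop) : Assertion → Prop
  | .ctx _ => True
  | .kind _ _ => True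
  | .fam Γ A _ => ∀ s r, EtaSubst p Γ s r → Conv (A.subst s) (A.rename r)
  | .obj Γ M _ => ∀ s r, EtaSubst p Γ s r → Conv (M.subst s) (M.rename r)

/-- In a canonical expression, substituting expanded variables creates redexes only at applied
heads, where `Spine.eta_head` contracts them. Restricting the expansion types by `p` lets this lemma
be used inside the size induction of `Derivable.conv_eta`. -/
theorem Derivable.etaStable_of {p : ℕ → Prop}
    (hp : ∀ Γ N A k, Derivable (.obj Γ N A) → p k → piCount A < k → Conv (eta A N) N)
    {J : Assertion} (h : Derivable J) : J.EtaStable p := by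
  have args : ∀ {c : Cat} {Γ : Ctx} {s : ℕ → Obj} {r : ℕ → ℕ} {t : ℕ → Obj} {e R : Exp c}
      {N : List Obj}, EtaSubst p Γ s r →
      Spine (fun M A => Derivable (.obj Γ M A) ∧ Assertion.EtaStable p (.obj Γ M A)) t e N R →
      List.Forall₂ Conv (N.map (Exp.subst s)) (N.map (Exp.rename r)) := by
    intro c Γ s r t e R N hs h
    rw [List.forall₂_map_left_iff, List.forall₂_map_right_iff, List.forall₂_same]
    intro M hM
    obtain ⟨B, hB⟩ := h.forall_mem M hM
    exact hB.2 _ _ hs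
  refine h.spine_induction (motive := Assertion.EtaStable p) trivial (fun _ _ _ _ _ => trivial)
    (fun _ _ _ _ => trivial) (fun _ _ => trivial) (fun _ _ _ _ => trivial) ?_ ?_ ?_ ?_ ?_
  · intro _ _ _ _ _ h1 h2 s r hs
    exact (h1 s r hs).piF (h2 _ _ (hs.up _))
  · intro _ _ _ _ _ _ h1 h2 s r hs
    exact (h1 s r hs).lamF (h2 _ _ (hs.up _))
  · intro _ _ _ _ _ _ h1 h2 s r hs
    exact (h1 s r hs).lamO (h2 _ _ (hs.up _))
  · intro _ _ _ _ _ _ h _ s r hs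
    rw [appsF_subst, appsF_rename]
    exact Conv.appsF (.refl _) (args hs h)
  · intro Γ y S N A hΓ hy h _ s r hs
    rw [appsO_subst, appsO_rename]
    refine (Conv.appsO (.refl _) (args hs h)).trans ?_
    rcases hs y S hy with h1 | ⟨h1, h2⟩
    · simp only [Exp.subst, h1]
      exact .refl _
    · simp only [Exp.subst, h2]
      -- The redexes are contracted in `Γ`, where the typing information lives, and the result is
      -- then renamed by `r`.
      have := Spine.eta_head (k := piCount S)
        (fun N B (hN : Derivable (.obj Γ N B) ∧ _) hB => hp Γ N B _ hN.1 h1 hB) h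
        (hΓ.skel hy) le_rfl (.var y)
      rw [subst_var] at this
      simpa only [appsO_rename, eta_rename, Exp.rename] using this.rename r

theorem Conv.eta (A : Fam) {M N : Obj} (h : Conv M N) : Conv (eta A M) (CanonicalLF.eta A N) := by
  induction hn : piCount A using Nat.strong_induction_on generalizing A M N with
  | _ n ih =>
    cases A with
    | piF C D =>
      simp only [piCount] at hn
      simp only [eta_piF]
      exact Conv.lamO (.refl _) (ih _ (by omega) _ ((h.rename _).appO (.refl _)) rfl)
    | _ => exact h

/-- Canonical objects are already eta-long. Expanding `λx:C.M` at `Πx:C.B` gives, after one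
contraction, `λx:C` over the expansion at `B` of `M` with `x` replaced by its own expansion. Both
expansions are at smaller types, so they disappear by induction on size. -/
theorem Derivable.conv_eta {Γ : Ctx} {N : Obj} {A : Fam} (h : Derivable (.obj Γ N A)) :
    Conv (eta A N) N := by
  have key : ∀ n Γ N A, Derivable (.obj Γ N A) → piCount A < n → Conv (eta A N) N := by
    intro n
    induction n with
    | zero => intro _ _ _ _ h; omega
    | succ n ih =>
      intro Γ N A h hA
      have h' := h
      generalize hJ : Assertion.obj Γ N A = J at h
      cases h with
      | @absObj Γ C B M h1 h2 =>
        cases hJ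
        simp only [piCount] at hA
        rw [eta_piF]
        have hs := h2.ctx.obj_cons_inv
        have hB : Conv ((Exp.lamO C M).shift.appO (eta C.shift (.var 0))) M := by
          refine (conv_betaO _ _ _).trans ?_
          rw [subst_rename]
          -- The domain `C` has size below `n`, and the expansions met inside are at types smaller
          -- than `C`, so the induction hypothesis covers them.
          have h3 := h2.etaStable_of (p := fun m => m < n)
            (fun Γ N A k hN hk hA => ih Γ N A hN (by omega))
            (scons (eta C.shift (.var 0)) fun x => .var (x + 1)) (fun x => x) ?_
          · rw [rename_id] at h3
            convert h3 using 2
            funext x; cases x <;> rfl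
          · intro x D hx
            cases x with
            | zero =>
              obtain rfl := hasObj_zero hx
              right
              rw [rename_id, Exp.shift, piCount_rename]
              exact ⟨by omega, rfl⟩
            | succ x => exact .inl rfl
        refine Conv.lamO (.refl _) (Conv.trans ?_ (ih _ _ _ h2 (by omega)))
        exact Conv.eta B hB
      | backchainObj =>
        cases hJ
        obtain ⟨S, -, hS⟩ := h'.appsO_inv
        rw [eta_of_not_piF hS.isBase.not_piF]
        exact .refl _
      | _ => cases hJ
  exact key _ _ _ _ h (Nat.lt_succ_self _)

theorem Derivable.etaStable {J : Assertion} (h : Derivable J) :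
    J.EtaStable fun _ => True :=
  h.etaStable_of fun _ _ _ _ h _ _ => h.conv_eta

/-! ### Renaming of derivations -/

theorem Spine.of_subst_rename {P : Obj → Fam → Prop} {s : ℕ → Obj} {r : ℕ → ℕ} {e R : Exp c}
    {N : List Obj} (h : Spine P (fun x => s (r x)) e N R) : Spine P s (e.rename r) N R := by
  induction N generalizing e s r with
  | nil =>
    cases h with
    | nil h1 h2 => exact (.nil (h1.rename r) (by rwa [subst_rename]))
  | cons Q N ih =>
    have hscons : (scons Q fun x => s (r x)) = fun x => scons Q s (upRen r x) := by
      funext x; cases x <;> rfl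
    cases h with
    | consF h1 h2 h3 =>
      exact .consF (by rwa [subst_rename]) h2 (ih (hscons ▸ h3))
    | consK h1 h2 h3 =>
      exact .consK (by rwa [subst_rename]) h2 (ih (hscons ▸ h3))

theorem Spine.subst_rename {P : Obj → Fam → Prop} {s : ℕ → Obj} {r : ℕ → ℕ} {e R : Exp c}
    {N : List Obj} (h : Spine P s (e.rename r) N R) : Spine P (fun x => s (r x)) e N R := by
  induction N generalizing e s r with
  | nil =>
    generalize he : e.rename r = e' at h
    cases h with
    | nil h1 h2 => subst he; exact .nil h1.of_rename (by rwa [CanonicalLF.subst_rename] at h2)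
  | cons Q N ih =>
    have hscons : (scons Q fun x => s (r x)) = fun x => scons Q s (upRen r x) := by
      funext x; cases x <;> rfl
    cases e with
    | piF =>
      cases h with
      | consF h1 h2 h3 =>
        exact .consF (by rwa [CanonicalLF.subst_rename] at h1) h2 (hscons ▸ ih h3)
    | piK =>
      cases h with
      | consK h1 h2 h3 =>
        exact .consK (by rwa [CanonicalLF.subst_rename] at h1) h2 (hscons ▸ ih h3)
    | _ => cases h

theorem Spine.rename {P Q : Obj → Fam → Prop} {r : ℕ → ℕ}
    (hPQ : ∀ N B, P N B → Q (N.rename r) (B.rename r)) {s : ℕ → Obj} {e R : Exp c}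
    {N : List Obj} (h : Spine P s e N R) :
    Spine Q (fun x => (s x).rename r) e (N.map (Exp.rename r)) (R.rename r) := by
  have hscons : ∀ (N : Obj) (s : ℕ → Obj),
      (fun x => (scons N s x).rename r) = scons (N.rename r) fun x => (s x).rename r := by
    intro N s; funext x; cases x <;> rfl
  induction h with
  | nil h1 h2 =>
    refine .nil h1 ?_
    rw [← rename_subst]; exact h2.rename r
  | consF h1 h2 _ ih =>
    refine .consF ?_ (hPQ _ _ h2) (hscons _ _ ▸ ih)
    rw [← rename_subst]; exact h1.rename r
  | consK h1 h2 _ ih =>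
    refine .consK ?_ (hPQ _ _ h2) (hscons _ _ ▸ ih)
    rw [← rename_subst]; exact h1.rename r

/-- `r` maps the declarations of `Γ` to declarations of `Γ'`. -/
structure IsRenaming (r : ℕ → ℕ) (Γ Γ' : Ctx) : Prop where
  obj : ∀ x A, HasObj Γ x A → HasObj Γ' (r x) (A.rename r)
  fam : ∀ u K, HasFam Γ u K → HasFam Γ' u (K.rename r)

theorem IsRenaming.up {r : ℕ → ℕ} {Γ Γ' : Ctx} (h : IsRenaming r Γ Γ') (A : Fam) :
    IsRenaming (upRen r) (.obj A :: Γ) (.obj (A.rename r) :: Γ') where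
  obj x B hx := by
    cases x with
    | zero =>
      obtain rfl := hasObj_zero hx
      rw [shift_rename_upRen]; exact .here
    | succ x =>
      obtain ⟨B, hx', rfl⟩ := hasObj_succ hx
      rw [shift_rename_upRen]; exact .skipObj (h.obj _ _ hx')
  fam u K hu := by
    obtain ⟨K, hu', rfl⟩ := hasFam_obj hu
    rw [shift_rename_upRen]; exact .skipObj (h.fam _ _ hu')

/-- Stability of an assertion under renamings. -/
def Assertion.Renamable : Assertion → Prop
  | .ctx _ => True
  | .kind _ _ => True
  | .fam Γ A K => ∀ r Γ', IsRenaming r Γ Γ' → Derivable (.ctx Γ') →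
      Derivable (.fam Γ' (A.rename r) (K.rename r))
  | .obj Γ M A => ∀ r Γ', IsRenaming r Γ Γ' → Derivable (.ctx Γ') →
      Derivable (.obj Γ' (M.rename r) (A.rename r))

theorem Derivable.renamable {J : Assertion} (h : Derivable J) : J.Renamable := by
  refine h.spine_induction (motive := Assertion.Renamable) trivial (fun _ _ _ _ _ => trivial)
    (fun _ _ _ _ => trivial) (fun _ _ => trivial) (fun _ _ _ _ => trivial) ?_ ?_ ?_ ?_ ?_
  · intro Γ A B _ _ h1 h2 r Γ' hr hΓ'
    have hA := h1 r Γ' hr hΓ'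
    exact .piFam hA (h2 _ _ (hr.up A) (.typeCtx hA hΓ'))
  · intro Γ A B K _ _ h1 h2 r Γ' hr hΓ'
    have hA := h1 r Γ' hr hΓ'
    exact .absFam hA (h2 _ _ (hr.up A) (.typeCtx hA hΓ'))
  · intro Γ A B M _ _ h1 h2 r Γ' hr hΓ'
    have hA := h1 r Γ' hr hΓ'
    exact .absObj hA (h2 _ _ (hr.up A) (.typeCtx hA hΓ'))
  · intro Γ u K N _ hu h _ r Γ' hr hΓ'
    rw [appsF_rename]
    refine Derivable.appsF_spine hΓ' (hr.fam u K hu) (Spine.of_subst_rename (R := .type) ?_)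
    exact h.rename (r := r) fun N B h => h.2 r Γ' hr hΓ'
  · intro Γ y S N A _ hy h _ r Γ' hr hΓ'
    rw [appsO_rename]
    refine Derivable.appsO_spine hΓ' (hr.obj y S hy) (Spine.of_subst_rename ?_)
    exact h.rename (r := r) fun N B h => h.2 r Γ' hr hΓ'

theorem Derivable.hasObj_type {Γ : Ctx} (h : Derivable (.ctx Γ)) {x : ℕ} {A : Fam}
    (hx : HasObj Γ x A) : Derivable (.fam Γ A .type) := by
  have shift : ∀ {Γ : Ctx} {A B : Fam}, Derivable (.fam Γ A .type) →
      Derivable (.ctx (.obj B :: Γ)) → Derivable (.fam (.obj B :: Γ) A.shift .type) :=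
    fun h h' => h.renamable _ _ ⟨fun _ _ h => .skipObj h, fun _ _ h => .skipObj h⟩ h'
  induction hx with
  | here => exact shift h.obj_cons_inv.1 h
  | skipObj _ ih => exact shift (ih h.ctx_tail) h
  | @skipFam Γ x u A K _ ih =>
    have := (ih h.ctx_tail).renamable (fun x => x) (.fam u K :: Γ)
      ⟨fun _ _ h => by rw [rename_id]; exact .skipFam h,
        fun _ _ h => by rw [rename_id]; exact .skipFam h⟩ h
    rwa [rename_id] at this

/-! ### Strengthening -/

/-- `r` is an injective renaming of the variables of `Γ` into those of `Γ'`, and all the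
declarations of `Γ'` for images of variables of `Γ` come from `Γ`. -/
structure Reflects (r : ℕ → ℕ) (Γ Γ' : Ctx) : Prop where
  inj : Function.Injective r
  obj : ∀ x A', HasObj Γ' (r x) A' → ∃ A, HasObj Γ x A ∧ A' = A.rename r
  fam : ∀ u ∈ famDom Γ, ∀ K', HasFam Γ' u K' → ∃ K, HasFam Γ u K ∧ K' = K.rename r

theorem Reflects.up {r : ℕ → ℕ} {Γ Γ' : Ctx} (h : Reflects r Γ Γ') (A : Fam) :
    Reflects (upRen r) (.obj A :: Γ) (.obj (A.rename r) :: Γ') where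
  inj := upRen_injective h.inj
  obj x B hx := by
    cases x with
    | zero =>
      obtain rfl := hasObj_zero hx
      exact ⟨_, .here, (shift_rename_upRen _ _).symm⟩
    | succ x =>
      obtain ⟨B', hx', rfl⟩ := hasObj_succ hx
      obtain ⟨B, hx'', rfl⟩ := h.obj _ _ hx'
      exact ⟨_, .skipObj hx'', (shift_rename_upRen _ _).symm⟩
  fam u hu K hK := by
    rw [famDom_obj] at hu
    obtain ⟨K', hK', rfl⟩ := hasFam_obj hK
    obtain ⟨K, hK'', rfl⟩ := h.fam u hu _ hK'
    exact ⟨_, .skipObj hK'', (shift_rename_upRen _ _).symm⟩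

/-- Allows a variable of `Γ'` outside the image of `r` to be taken as the new innermost variable of
`Γ`, wherever it is declared in `Γ'`. -/
theorem Reflects.scons {r : ℕ → ℕ} {Γ Γ' : Ctx} (h : Reflects r Γ Γ') {A : Fam} {y : ℕ}
    (hy : HasObj Γ' y (A.rename r)) (hr : ∀ x, r x ≠ y) :
    Reflects (scons y r) (.obj A :: Γ) Γ' where
  inj := by
    intro a b hab
    cases a <;> cases b
    · rfl
    · exact absurd hab.symm (hr _)
    · exact absurd hab (hr _)
    · exact congrArg _ (h.inj hab)
  obj x B hx := by
    cases x with
    | zero => exact ⟨_, .here, by rw [shift_rename_scons]; exact hx.unique hy⟩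
    | succ x =>
      obtain ⟨B, hx', rfl⟩ := h.obj _ _ hx
      exact ⟨_, .skipObj hx', (shift_rename_scons _ _ _).symm⟩
  fam u hu K hK := by
    rw [famDom_obj] at hu
    obtain ⟨K, hK', rfl⟩ := h.fam u hu _ hK
    exact ⟨_, .skipObj hK', (shift_rename_scons _ _ _).symm⟩

theorem appsO_var_eq_rename {y : ℕ} {N : List Obj} {M : Obj} {r : ℕ → ℕ}
    (h : appsO (.var y) N = M.rename r) :
    ∃ x P, M = appsO (.var x) P ∧ y = r x ∧ N = P.map (Exp.rename r) := by
  induction N using List.reverseRecOn generalizing M with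
  | nil =>
    cases M <;> simp [appsO, Exp.rename] at h
    exact ⟨_, [], rfl, h, rfl⟩
  | append_singleton N Q ih =>
    rw [appsO_concat] at h
    cases M <;> simp only [Exp.rename, reduceCtorEq, Exp.appO.injEq] at h
    obtain ⟨x, P, rfl, rfl, rfl⟩ := ih h.1
    exact ⟨x, P ++ [_], (appsO_concat _ _ _).symm, rfl, by simp [h.2]⟩

theorem appsF_tvar_eq_rename {u : ℕ} {N : List Obj} {A : Fam} {r : ℕ → ℕ}
    (h : appsF (.tvar u) N = A.rename r) :
    ∃ P, A = appsF (.tvar u) P ∧ N = P.map (Exp.rename r) := by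
  induction N using List.reverseRecOn generalizing A with
  | nil =>
    cases A <;> simp [appsF, Exp.rename] at h
    exact ⟨[], by simp [appsF, h], rfl⟩
  | append_singleton N Q ih =>
    rw [appsF_concat] at h
    cases A <;> simp only [Exp.rename, reduceCtorEq, Exp.appF.injEq] at h
    obtain ⟨P, rfl, rfl⟩ := ih h.1
    exact ⟨P ++ [_], (appsF_concat _ _ _).symm, by simp [h.2]⟩

/-- Normal forms of renamed domains are renamings, so the spine can be pulled back argument by
argument. Skeletons pass to instances of domains and their reducts, so `hPQ` need only treat types
over `U`. -/
theorem Spine.of_rename {P Q : Obj → Fam → Prop} {r : ℕ → ℕ} {U : Set ℕ}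
    (hPQ : ∀ N B, P (N.rename r) (B.rename r) → Skel U B → Q N B) {s : ℕ → Obj} {e R : Exp c}
    (he : Skel U e) {N : List Obj}
    (h : Spine P (fun x => (s x).rename r) e (N.map (Exp.rename r)) R) :
    ∃ R', R = R'.rename r ∧ Spine Q s e N R' := by
  have hscons : ∀ (N : Obj) (s : ℕ → Obj),
      scons (N.rename r) (fun x => (s x).rename r) = (fun x => (scons N s x).rename r) := by
    intro N s; funext x; cases x <;> rfl
  induction N generalizing s e with
  | nil =>
    cases h with
    | nil h1 h2 =>
      rw [← rename_subst] at h2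
      obtain ⟨R', h3, rfl⟩ := h2.of_rename
      exact ⟨R', rfl, .nil h1 h3⟩
  | cons M N ih =>
    cases h with
    | consF h1 h2 h3 =>
      obtain ⟨hB, hS⟩ := he.piF_inv
      rw [← rename_subst] at h1
      obtain ⟨B', h5, rfl⟩ := h1.of_rename
      obtain ⟨R', rfl, h4⟩ := ih hS (hscons _ _ ▸ h3)
      exact ⟨R', rfl, .consF h5 (hPQ _ _ h2 ((hB.subst s).red h5.1)) h4⟩
    | consK h1 h2 h3 =>
      cases he with
      | piK hB hS =>
        rw [← rename_subst] at h1
        obtain ⟨B', h5, rfl⟩ := h1.of_rename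
        obtain ⟨R', rfl, h4⟩ := ih hS (hscons _ _ ▸ h3)
        exact ⟨R', rfl, .consK h5 (hPQ _ _ h2 ((hB.subst s).red h5.1)) h4⟩

/-- Stability of an assertion under inverses of reflecting renamings. -/
def Assertion.Strengthenable : Assertion → Prop
  | .ctx _ => True
  | .kind _ _ => True
  | .fam Γ' A' _ => ∀ r Γ A, Reflects r Γ Γ' → Derivable (.ctx Γ) → A' = A.rename r →
      Skel (famDom Γ) A → Derivable (.fam Γ A .type)
  | .obj Γ' M' T' => ∀ r Γ M T, Reflects r Γ Γ' → Derivable (.ctx Γ) → M' = M.rename r →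
      T' = T.rename r → Skel (famDom Γ) T → Derivable (.obj Γ M T)

/-- Checking a canonical subject consults only the declarations of its variables. Annotations of
abstractions are domains of the type being checked, and argument types come from declarations in
`Γ`; hence every type checked is a skeleton over `Γ`, and its head type variables are declared
there. -/
theorem Derivable.strengthenable {J : Assertion} (h : Derivable J) : J.Strengthenable := by
  refine h.spine_induction (motive := Assertion.Strengthenable) trivial (fun _ _ _ _ _ => trivial)
    (fun _ _ _ _ => trivial) (fun _ _ => trivial) (fun _ _ _ _ => trivial) ?_ ?_ ?_ ?_ ?_
  · intro Γ' A' B' _ _ h1 h2 r Γ X hr hΓ hX hskel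
    cases X <;> simp only [Exp.rename, reduceCtorEq, Exp.piF.injEq] at hX
    obtain ⟨rfl, rfl⟩ := hX
    obtain ⟨hA, hB⟩ := hskel.piF_inv
    have hA' := h1 r Γ _ hr hΓ rfl hA
    exact .piFam hA' (h2 _ _ _ (hr.up _) (.typeCtx hA' hΓ) rfl (by rwa [famDom_obj]))
  · intro Γ' A' B' K' _ _ h1 h2 r Γ X hr hΓ hX hskel
    cases X <;> simp only [Exp.rename, reduceCtorEq] at hX
    -- An abstracted family is not a skeleton.
    cases hskel with | base _ h => cases h
  · intro Γ' A' B' M' _ _ h1 h2 r Γ X T hr hΓ hX hT hskel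
    cases X <;> simp only [Exp.rename, reduceCtorEq, Exp.lamO.injEq] at hX
    cases T <;> simp only [Exp.rename, reduceCtorEq, Exp.piF.injEq] at hT
    obtain ⟨rfl, rfl⟩ := hX
    obtain ⟨hT, rfl⟩ := hT
    -- The annotation and the domain agree after renaming, and `r` is injective.
    obtain rfl := rename_injective hr.inj hT
    obtain ⟨hA, hB⟩ := hskel.piF_inv
    have hA' := h1 r Γ _ hr hΓ rfl hA
    exact .absObj hA' (h2 _ _ _ _ (hr.up _) (.typeCtx hA' hΓ) rfl rfl (by rwa [famDom_obj]))
  · intro Γ' u K' N' _ hu h _ r Γ X hr hΓ hX hskel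
    obtain ⟨N, rfl, rfl⟩ := appsF_tvar_eq_rename hX
    have hu' : u ∈ famDom Γ := by
      generalize hY : appsF (.tvar u) N = Y at hskel
      cases hskel with
      | base hv h' => exact ((hY ▸ IsAtom.appsF .tvar N : IsAtom u Y).unique h') ▸ hv
      | piF => exact absurd hY ((IsAtom.appsF .tvar N).not_piF _ _)
    obtain ⟨K, hK, rfl⟩ := hr.fam u hu' _ hu
    obtain ⟨R, hR, h'⟩ := Spine.of_rename (s := .var)
      (Q := fun M T => Derivable (.obj Γ M T)) (U := famDom Γ)
      (fun M T h hT => h.2 r Γ M T hr hΓ rfl rfl hT) (hΓ.allSkel.2 _ _ hK) h.subst_rename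
    cases R with
    | type => exact .appsF_spine hΓ hK h'
    | piK => cases hR
  · intro Γ' y S' N' T' _ hy h _ r Γ X T hr hΓ hX hT hskel
    obtain ⟨x, N, rfl, rfl, rfl⟩ := appsO_var_eq_rename hX
    obtain ⟨S, hS, rfl⟩ := hr.obj x _ hy
    obtain ⟨R, hR, h'⟩ := Spine.of_rename (s := .var)
      (Q := fun M T => Derivable (.obj Γ M T)) (U := famDom Γ)
      (fun M T h hT => h.2 r Γ M T hr hΓ rfl rfl hT) (hΓ.skel hS) h.subst_rename
    obtain rfl := rename_injective hr.inj (hR.symm.trans hT)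
    exact .appsO_spine hΓ hS h'

/-! ### Products applied to eta-expanded variables -/

/-- `VarSpine Γ r S y P r' S'`: the product type `S`, renamed by `r`, can be applied to the
variables `y`, whose eta-expansions at their types are `P`, and the result is `S'` renamed by
`r'`. -/
inductive VarSpine (Γ : Ctx) :
    (ℕ → ℕ) → Fam → List ℕ → List Obj → (ℕ → ℕ) → Fam → Prop
  | nil {r : ℕ → ℕ} {S : Fam} : VarSpine Γ r S [] [] r S
  | cons {r r' : ℕ → ℕ} {B S S' : Fam} {y : ℕ} {ys : List ℕ} {Ps : List Obj} :
      HasObj Γ y (B.rename r) → VarSpine Γ (scons y r) S ys Ps r' S' →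
      VarSpine Γ r (.piF B S) (y :: ys) (eta (B.rename r) (.var y) :: Ps) r' S'

theorem VarSpine.concat_inv {Γ : Ctx} {r r' : ℕ → ℕ} {S S' : Fam} {y : ℕ} {ys : List ℕ}
    {P : Obj} {Ps : List Obj} (h : VarSpine Γ r S (ys ++ [y]) (Ps ++ [P]) r' S') :
    ∃ r₁ B, VarSpine Γ r S ys Ps r₁ (.piF B S') ∧ HasObj Γ y (B.rename r₁) ∧
      r' = scons y r₁ := by
  generalize hys : ys ++ [y] = zs at h
  generalize hPs : Ps ++ [P] = Qs at h
  induction h generalizing ys Ps with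
  | nil => simp at hys
  | @cons r r' B S S' z zs Qs h1 h2 ih =>
    cases ys with
    | nil =>
      simp only [List.nil_append, List.cons.injEq] at hys
      obtain ⟨rfl, rfl⟩ := hys
      cases Ps with
      | nil =>
        cases h2
        exact ⟨_, _, .nil, h1, rfl⟩
      | cons Q Ps =>
        simp only [List.cons_append, List.cons.injEq] at hPs
        obtain ⟨-, rfl⟩ := hPs
        cases Ps <;> cases h2
    | cons x ys =>
      simp only [List.cons_append, List.cons.injEq] at hys
      obtain ⟨rfl, rfl⟩ := hys
      cases Ps with
      | nil =>
        simp only [List.nil_append, List.cons.injEq] at hPs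
        obtain ⟨-, rfl⟩ := hPs
        cases ys <;> cases h2
      | cons Q Ps =>
        simp only [List.cons_append, List.cons.injEq] at hPs
        obtain ⟨rfl, rfl⟩ := hPs
        obtain ⟨r₁, B', h3, h4, h5⟩ := ih rfl rfl
        exact ⟨r₁, B', .cons h1 h3, h4, h5⟩

theorem VarSpine.unshift {Γ : Ctx} {A : Fam} {r r' : ℕ → ℕ} {S S' : Fam} {ys : List ℕ}
    {Ps : List Obj}
    (h : VarSpine (.obj A :: Γ) (fun x => r x + 1) S (ys.map Nat.succ) (Ps.map Exp.shift) r' S') :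
    ∃ r₁, r' = (fun x => r₁ x + 1) ∧ VarSpine Γ r S ys Ps r₁ S' := by
  induction ys generalizing r S Ps with
  | nil =>
    cases Ps with
    | nil => cases h; exact ⟨r, rfl, .nil⟩
    | cons => cases h
  | cons y ys ih =>
    cases Ps with
    | nil => cases h
    | cons P Ps =>
      generalize hP : (P :: Ps).map Exp.shift = Qs at h
      cases h with
      | @cons _ _ B S _ _ _ Qs h1 h2 =>
        simp only [List.map_cons, List.cons.injEq] at hP
        obtain ⟨hP, rfl⟩ := hP
        have hB : B.rename (fun x => r x + 1) = (B.rename r).shift := by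
          rw [Exp.shift, rename_rename]
        have hr : scons (Nat.succ y) (fun x => r x + 1) = fun x => scons y r x + 1 := by
          funext x; cases x <;> rfl
        rw [hB] at h1 hP
        rw [hr] at h2
        obtain ⟨B', h1, h3⟩ := hasObj_succ h1
        obtain rfl := shift_injective h3
        have hP' : (eta (B.rename r) (.var y)).shift = P.shift := by
          rw [hP, Exp.shift, eta_rename]; rfl
        obtain rfl := shift_injective hP'
        obtain ⟨r₁, rfl, h4⟩ := ih h2
        exact ⟨r₁, rfl, .cons h1 h4⟩

/-- The eta-expanded variables whose expansion has size satisfying `p` have their declared types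
as only types, and are expanded at these. -/
def EtaVarsTyped (p : ℕ → Prop) : Prop :=
  ∀ Γ T y C, p (piCount T) → Derivable (.obj Γ (eta T (.var y)) C) →
    HasObj Γ y C ∧ eta T (.var y) = eta C (.var y)

/-- The substitution accumulated along the spine consists of expanded variables, so by eta-stability
it acts on the canonical type `S` as a renaming, up to conversion. The domain types are thus literal
renamings. -/
theorem Spine.varSpine {p : ℕ → Prop} (hp : EtaVarsTyped p) {Γ₀ Γ : Ctx} {S A : Fam}
    {s : ℕ → Obj} {r : ℕ → ℕ} {ys : List ℕ} {Ps : List Obj}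
    (hS : Derivable (.fam Γ₀ S .type)) (hs : EtaSubst (fun _ => True) Γ₀ s r)
    (h : Spine (fun M B => Derivable (.obj Γ M B)) s S Ps A)
    (hPs : List.Forall₂ (fun y P => ∃ T, p (piCount T) ∧ P = eta T (.var y)) ys Ps) :
    ∃ r' S', VarSpine Γ r S ys Ps r' S' ∧ IsBase S' ∧ A = S'.rename r' := by
  induction hPs generalizing Γ₀ S s r with
  | nil =>
    cases h with
    | nil h1 h2 =>
      refine ⟨r, S, .nil, h1, h2.unique (Conv.betaNF (hS.etaStable s r hs) ?_)⟩
      exact Normal.rename hS.allNormal r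
  | @cons y P ys Ps hP _ ih =>
    obtain ⟨T, hT, rfl⟩ := hP
    cases h with
    | @consF _ B B' S _ _ _ h1 h2 h3 =>
      have hBS : Derivable (.fam Γ₀ B .type) ∧ Derivable (.fam (.obj B :: Γ₀) S .type) := by
        generalize hX : Exp.piF B S = X at hS
        cases hS with
        | piFam h4 h5 => cases hX; exact ⟨h4, h5⟩
        | backchainFam =>
          exact absurd hX.symm ((IsAtom.appsF .tvar _).not_piF _ _)
      obtain ⟨hB, hS⟩ := hBS
      obtain rfl : B' = B.rename r :=
        h1.unique (Conv.betaNF (hB.etaStable s r hs) (Normal.rename hB.allNormal r))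
      obtain ⟨hy, heq⟩ := hp _ _ _ _ hT h2
      rw [heq] at h3 ⊢
      obtain ⟨r', S', h4, h5, h6⟩ := ih hS (hs.scons trivial y) h3
      exact ⟨r', S', .cons hy h4, h5, h6⟩

theorem Fam.pi_induction {motive : Fam → Prop}
    (piF : ∀ C D, motive D → motive (.piF C D))
    (other : ∀ A, (∀ C D, A ≠ .piF C D) → motive A) (A : Fam) : motive A := by
  induction hn : piCount A using Nat.strong_induction_on generalizing A with
  | _ n ih =>
    cases A with
    | piF C D =>
      simp only [piCount] at hn
      exact piF C D (ih _ (by omega) D rfl)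
    | _ => exact other _ (by simp)

/-- Descending under the abstractions of the expansion at `T` appends one expanded variable to the
spine each time, at a domain smaller than `n`. At the bottom the backchaining rule compares the
whole spine with the declared type of the head, and on the way back the last variable is split off.
-/
theorem EtaVarsTyped.varSpine {p : ℕ → Prop} (hp : EtaVarsTyped p) {n : ℕ}
    (hn : ∀ m < n, p m) {Γ₀ : Ctx} {S₀ : Fam} (hS₀ : Derivable (.fam Γ₀ S₀ .type)) (T : Fam) :
    piCount T ≤ n → ∀ (Γ : Ctx) (r : ℕ → ℕ) (y : ℕ) (ys : List ℕ) (Ps : List Obj) (C : Fam),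
      HasObj Γ y (S₀.rename r) →
      List.Forall₂ (fun y P => ∃ T, p (piCount T) ∧ P = eta T (.var y)) ys Ps →
      Derivable (.obj Γ (eta T (appsO (.var y) Ps)) C) →
      ∃ r' S, VarSpine Γ r S₀ ys Ps r' S ∧ C = S.rename r' ∧
        eta T (appsO (.var y) Ps) = eta (S.rename r') (appsO (.var y) Ps) := by
  have base : ∀ (Γ : Ctx) (r : ℕ → ℕ) (y : ℕ) (ys : List ℕ) (Ps : List Obj) (C : Fam),
      HasObj Γ y (S₀.rename r) →
      List.Forall₂ (fun y P => ∃ T, p (piCount T) ∧ P = eta T (.var y)) ys Ps →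
      Derivable (.obj Γ (appsO (.var y) Ps) C) →
      ∃ r' S, VarSpine Γ r S₀ ys Ps r' S ∧ C = S.rename r' ∧
        appsO (.var y) Ps = eta (S.rename r') (appsO (.var y) Ps) := by
    intro Γ r y ys Ps C hy hPs h
    obtain ⟨S, hS, h⟩ := h.appsO_inv
    obtain rfl := hS.unique hy
    obtain ⟨r', S', h1, h2, h3⟩ := Spine.varSpine hp hS₀ (fun x A hx => .inl rfl)
      h.subst_rename hPs
    refine ⟨r', S', h1, h3, ?_⟩
    rw [eta_of_not_piF (IsBase.not_piF (IsBase.rename_iff.2 h2))]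
  induction T using Fam.pi_induction with
  | piF T₁ T₂ ih =>
    intro hT Γ r y ys Ps C hy hPs h
    simp only [piCount] at hT
    rw [eta_piF] at h
    obtain ⟨C, rfl, -, h⟩ := h.lamO_inv
    have heq : (appsO (.var y) Ps).shift.appO (eta T₁.shift (.var 0)) =
        appsO (.var (y + 1)) (Ps.map Exp.shift ++ [eta T₁.shift (.var 0)]) := by
      rw [appsO_concat, Exp.shift, appsO_rename]; rfl
    rw [heq] at h
    obtain ⟨r', S, h1, h2, h3⟩ := ih (by omega) _ (fun x => r x + 1) (y + 1)
      (ys.map Nat.succ ++ [0]) _ _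
      (by have := HasObj.skipObj (B := T₁) hy
          rwa [Exp.shift, rename_rename] at this)
      (by
        refine forall₂_concat ?_ ⟨T₁.shift, hn _ ?_, rfl⟩
        · rw [List.forall₂_map_left_iff, List.forall₂_map_right_iff]
          refine hPs.imp ?_
          rintro y _ ⟨T, hT, rfl⟩
          exact ⟨T.shift, by rwa [Exp.shift, piCount_rename], by
            rw [Exp.shift, eta_rename]; rfl⟩
        · rw [Exp.shift, piCount_rename]; omega) h
    obtain ⟨r₁, B, h4, h5, rfl⟩ := h1.concat_inv
    obtain ⟨r₂, rfl, h6⟩ := h4.unshift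
    -- The bound variable is declared with the annotation `T₁`, while the spine requires the head's
    -- domain for it; declarations are unique.
    have hB : T₁ = B.rename r₂ := by
      have := hasObj_zero h5
      refine (shift_injective ?_).symm
      rw [← this, Exp.shift, rename_rename]
    subst hB
    have hup : scons 0 (fun x => r₂ x + 1) = upRen r₂ := by
      funext x; cases x <;> rfl
    rw [hup] at h2 h3
    refine ⟨r₂, _, h6, by rw [h2]; rfl, ?_⟩
    simp only [Exp.rename, eta_piF]
    rw [heq, h3]
  | other T hT =>
    simp only [eta_of_not_piF hT]
    intro _ Γ r y ys Ps C hy hPs h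
    exact base Γ r y ys Ps C hy hPs h

theorem Derivable.exists_hasObj_of_eta {Γ : Ctx} {T C : Fam} {y : ℕ} {Ps : List Obj}
    (h : Derivable (.obj Γ (eta T (appsO (.var y) Ps)) C)) : ∃ S, HasObj Γ y S := by
  induction T using Fam.pi_induction generalizing Γ C y Ps with
  | piF T₁ T₂ ih =>
    rw [eta_piF] at h
    obtain ⟨C, rfl, -, h⟩ := h.lamO_inv
    have heq : (appsO (.var y) Ps).shift.appO (eta T₁.shift (.var 0)) =
        appsO (.var (y + 1)) (Ps.map Exp.shift ++ [eta T₁.shift (.var 0)]) := by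
      rw [appsO_concat, Exp.shift, appsO_rename]; rfl
    rw [heq] at h
    obtain ⟨S, hS⟩ := ih h
    obtain ⟨S, hS, -⟩ := hasObj_succ hS
    exact ⟨S, hS⟩
  | other T hT =>
    rw [eta_of_not_piF hT] at h
    obtain ⟨S, hS, -⟩ := h.appsO_inv
    exact ⟨S, hS⟩

/-- Induction on a size bound: inside an expansion at `T`, the arguments are variables expanded at
strictly smaller types. -/
theorem etaVarsTyped : EtaVarsTyped fun _ => True := by
  have key : ∀ n, EtaVarsTyped fun m => m < n := by
    intro n
    induction n with
    | zero => intro _ _ _ _ h; exact absurd h (Nat.not_lt_zero _)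
    | succ n ih =>
      intro Γ T y C hT h
      obtain ⟨S, hS⟩ := Derivable.exists_hasObj_of_eta (Ps := []) h
      obtain ⟨r', S', h1, h2, h3⟩ := ih.varSpine (fun _ h => h) (h.ctx.hasObj_type hS) T
        (Nat.lt_succ_iff.1 hT) Γ (fun x => x) y [] [] C (by rwa [rename_id]) .nil h
      cases h1
      rw [rename_id] at h2 h3
      subst h2
      exact ⟨hS, h3⟩
  exact fun Γ T y C _ h => key (piCount T + 1) Γ T y C (Nat.lt_succ_self _) h

/-! ### Instantiation of an applied variable -/

/-- Abstracts a typing in `Γ'` over the variables `ys` and lands in `Γ`. Each step adds to `Γ` a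
declaration that `r` sends to the next `y`, and replaces `Q` by its application to the expanded new
variable; once `ys` is used up, the given typing of `M'` is strengthened. Distinctness of the `ys`
keeps `r` injective. -/
theorem VarSpine.exists_longForm {Γ₀ Γ' : Ctx} {σ : ℕ → Obj} {d : ℕ} {ρ ρ' : ℕ → ℕ} {S S' : Fam}
    {ys : List ℕ} {Ps : List Obj} (h : VarSpine Γ₀ ρ S ys Ps ρ' S') (hS' : IsBase S')
    (hσ : ∀ y < d, σ y = .var y)
    (hΓ' : Derivable (.ctx Γ'))
    (hdecl : ∀ y < d, ∀ T, HasObj Γ₀ y T → ∃ T', HasObj Γ' y T' ∧ Conv T' (T.subst σ))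
    {M' : Obj} {A' : Fam} (hM' : Derivable (.obj Γ' M' A'))
    (hA' : Conv A' ((S'.rename ρ').subst σ))
    (hys : ∀ y ∈ ys, y < d) (hnodup : ys.Nodup)
    {Γ : Ctx} (hΓ : Derivable (.ctx Γ)) {r : ℕ → ℕ} (hr : Reflects r Γ Γ')
    (hrys : ∀ x, r x ∉ ys) {θ : ℕ → Obj} (hθ : ∀ x, σ (ρ x) = (θ x).rename r)
    (hskel : Skel (famDom Γ) S) {Q : Obj}
    (hQ : Conv (appsO (Q.rename r) (Ps.map (Exp.subst σ))) M') :
    ∃ B' N', BetaNF (S.subst θ) B' ∧ LongForm B' Q N' ∧ Derivable (.obj Γ N' B') := by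
  have hcomp : ∀ {ρ r : ℕ → ℕ} {θ : ℕ → Obj}, (∀ x, σ (ρ x) = (θ x).rename r) → ∀ B : Fam,
      (B.rename ρ).subst σ = (B.subst θ).rename r := by
    intro ρ r θ h B
    rw [subst_rename, rename_subst]
    congr 1; funext x; exact h x
  induction h generalizing Γ r θ Q with
  | @nil ρ S =>
    rw [hcomp hθ] at hA'
    -- The target has a normal form because `A'` is normal and convertible to it.
    have hA := hA'.symm.betaNF hM'.allNormal.2
    obtain ⟨B', hB', rfl⟩ := hA.of_rename
    obtain ⟨N', hN', rfl⟩ := (Conv.betaNF hQ hM'.allNormal.1).of_rename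
    refine ⟨B', N', hB', ?_, hM'.strengthenable _ _ _ _ hr hΓ rfl rfl
      ((hskel.subst θ).red hB'.1)⟩
    rw [LongForm, eta_of_not_piF]
    · exact hN'
    · exact ((IsBase.subst_iff.2 hS').red hB'.1).not_piF
  | @cons ρ ρ' B S S' y ys Ps h1 h2 ih =>
    simp only [List.mem_cons, forall_eq_or_imp, List.nodup_cons, not_or] at hys hnodup hrys
    obtain ⟨hB, hS⟩ := hskel.piF_inv
    obtain ⟨T', hT', hconv⟩ := hdecl y hys.1 _ h1
    rw [hcomp hθ] at hconv
    have hT := hΓ'.hasObj_type hT'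
    -- The normal form of the domain is read off from the normal type of `y` in `Γ'`.
    obtain ⟨B', hB', rfl⟩ := (hconv.symm.betaNF hT.allNormal).of_rename
    have hskB' := (hB.subst θ).red hB'.1
    have hB'ty := hT.strengthenable _ _ _ hr hΓ rfl hskB'
    have hθ' : ∀ x, σ (scons y ρ x) = (up θ x).rename (scons y r) := by
      intro x
      cases x with
      | zero => exact hσ y hys.1
      | succ x => rw [up_succ, shift_rename_scons]; exact hθ x
    obtain ⟨B₂, N₂, h3, h4, h5⟩ := ih hS' hA' hys.2 hnodup.2 (.typeCtx hB'ty hΓ)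
      (hr.scons hT' fun x => (hrys x).1)
      (by
        intro x
        cases x with
        | zero => exact hnodup.1
        | succ x => exact (hrys x).2)
      hθ' (by rwa [famDom_obj]) (Q := .appO Q.shift (eta B'.shift (.var 0)))
      (by
        -- The extended renaming sends the new variable back to `y`, so the extended `Q` becomes the
        -- old one applied to its first argument, up to expanding at convertible types.
        refine Conv.trans (Conv.appsO ?_ (List.forall₂_same.2 fun _ _ => Conv.refl _)) hQ
        simp only [Exp.rename, eta_rename, shift_rename_scons, scons_zero]
        refine Conv.appO (.refl _) ?_
        rw [eta_subst, hcomp hθ, Exp.subst, hσ y hys.1]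
        exact (hskB'.rename _).eta_conv ((hB.subst θ).rename r) (hB'.conv.symm.rename r) (.refl _))
    refine ⟨.piF B' B₂, .lamO B' N₂, hB'.piF h3, ?_, .absObj hB'ty h5⟩
    rw [LongForm, eta_piF]
    exact BetaNF.lamO ⟨.refl, hB'.2⟩ h4

/-! ### Lookup in concatenated and instantiated contexts -/

theorem shift_rename_add {c : Cat} (e : Exp c) (d : ℕ) :
    (e.rename (· + d)).shift = e.rename (· + (d + 1)) := rename_rename _ _ _

theorem objCount_append (Δ Γ : Ctx) : objCount (Δ ++ Γ) = objCount Δ + objCount Γ := by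
  induction Δ with
  | nil => simp [objCount]
  | cons d Δ ih => cases d <;> simp [objCount, ih]; omega

theorem telescope_concat (B : List Fam) (A : Fam) :
    telescope (B ++ [A]) = .obj A :: telescope B := by
  simp [telescope]

theorem objCount_telescope (B : List Fam) : objCount (telescope B) = B.length := by
  induction B using List.reverseRecOn with
  | nil => rfl
  | append_singleton B A ih => simp [telescope_concat, objCount, ih]

theorem famDom_telescope_append (B : List Fam) (Γ : Ctx) :
    famDom (telescope B ++ Γ) = famDom Γ := by
  induction B using List.reverseRecOn with
  | nil => rfl
  | append_singleton B A ih => rw [telescope_concat, List.cons_append, famDom_obj, ih]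

theorem HasObj.append {Γ : Ctx} {x : ℕ} {A : Fam} (h : HasObj Γ x A) (Δ : Ctx) :
    HasObj (Δ ++ Γ) (x + objCount Δ) (A.rename (· + objCount Δ)) := by
  induction Δ with
  | nil => simpa only [objCount, List.nil_append, add_zero, rename_id] using h
  | cons d Δ ih =>
    cases d with
    | obj B =>
      have := HasObj.skipObj (B := B) ih
      rwa [shift_rename_add] at this
    | fam u K => exact .skipFam ih

theorem HasObj.of_append {Δ Γ : Ctx} {x : ℕ} {A : Fam} (h : HasObj (Δ ++ Γ) (x + objCount Δ) A) :
    ∃ B, HasObj Γ x B ∧ A = B.rename (· + objCount Δ) := by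
  induction Δ generalizing A with
  | nil => exact ⟨A, h, (rename_id A).symm⟩
  | cons d Δ ih =>
    cases d with
    | obj B =>
      obtain ⟨A, h', rfl⟩ := hasObj_succ h
      obtain ⟨B, h'', rfl⟩ := ih h'
      exact ⟨B, h'', shift_rename_add _ _⟩
    | fam u K => cases h with | skipFam h => exact ih h

theorem HasFam.append {Γ : Ctx} {u : ℕ} {K : Kind} (h : HasFam Γ u K) (Δ : Ctx) :
    ∃ L, HasFam (Δ ++ Γ) u L := by
  induction Δ with
  | nil => exact ⟨K, h⟩
  | cons d Δ ih =>
    obtain ⟨L, ih⟩ := ih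
    cases d with
    | obj B => exact ⟨_, .skipObj ih⟩
    | fam u K => exact ⟨_, .skipFam ih⟩

/-- Freshness in well-formed contexts excludes that `Δ` shadows a type variable of `Γ`. -/
theorem HasFam.of_append {Δ Γ : Ctx} (hctx : Derivable (.ctx (Δ ++ Γ))) {u : ℕ} {K : Kind}
    (h : HasFam (Δ ++ Γ) u K) (hu : u ∈ famDom Γ) :
    ∃ L, HasFam Γ u L ∧ K = L.rename (· + objCount Δ) := by
  induction Δ generalizing K with
  | nil => exact ⟨K, h, (rename_id K).symm⟩
  | cons d Δ ih =>
    cases d with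
    | obj B =>
      obtain ⟨K, h', rfl⟩ := hasFam_obj h
      obtain ⟨L, h'', rfl⟩ := ih hctx.ctx_tail h'
      exact ⟨L, h'', shift_rename_add _ _⟩
    | fam v L =>
      cases h with
      | here =>
        obtain ⟨L, hL⟩ := hu
        obtain ⟨L, hL⟩ := hL.append Δ
        exact absurd hL (hctx.fam_cons_inv.2.2 L)
      | skipFam h => exact ih hctx.ctx_tail h

theorem reflects_add {Δ Γ : Ctx} (hctx : Derivable (.ctx (Δ ++ Γ))) :
    Reflects (· + objCount Δ) Γ (Δ ++ Γ) where
  inj := add_left_injective _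
  obj _ _ h := h.of_append
  fam _ hu _ h := h.of_append hctx hu

theorem upN_lt {d x : ℕ} (h : x < d) (s : ℕ → Obj) : upN d s x = .var x := by
  induction d generalizing x with
  | zero => omega
  | succ d ih =>
    cases x with
    | zero => rfl
    | succ x => rw [upN, up_succ, ih (by omega)]; rfl

theorem upN_add (d x : ℕ) (s : ℕ → Obj) : upN d s (x + d) = (s x).rename (· + d) := by
  induction d with
  | zero => exact (rename_id _).symm
  | succ d ih => rw [upN, ← add_assoc, up_succ, ih, shift_rename_add]

theorem CtxNF.objCount_eq {Δ Δ' : Ctx} {s : ℕ → Obj} (h : CtxNF (substCtx s Δ) Δ') :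
    objCount Δ' = objCount Δ := by
  induction Δ generalizing Δ' with
  | nil => cases h; rfl
  | cons d Δ ih =>
    cases h with
    | cons h1 h2 =>
      cases d <;> cases h1 <;> simp [objCount, ih h2]

theorem CtxNF.hasObj {Δ Δ' Θ Γ : Ctx} {s : ℕ → Obj} (h : CtxNF (substCtx s Δ) Δ') {y : ℕ}
    (hy : y < objCount Δ) {S : Fam} (hS : HasObj (Δ ++ Θ) y S) :
    ∃ S', HasObj (Δ' ++ Γ) y S' ∧ Conv S' (S.subst (upN (objCount Δ) s)) := by
  induction Δ generalizing Δ' y S with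
  | nil => exact absurd hy (Nat.not_lt_zero _)
  | cons d Δ ih =>
    cases h with
    | cons h1 h2 =>
      cases d with
      | obj A =>
        cases h1 with
        | obj h1 =>
          cases y with
          | zero =>
            obtain rfl := hasObj_zero hS
            refine ⟨_, .here, ?_⟩
            rw [objCount, upN, shift_subst_up]
            exact h1.conv.symm.rename _
          | succ y =>
            obtain ⟨S, hS', rfl⟩ := hasObj_succ hS
            obtain ⟨S', h3, h4⟩ := ih h2 (Nat.lt_of_succ_lt_succ hy) hS'
            refine ⟨_, .skipObj h3, ?_⟩
            rw [objCount, upN, shift_subst_up]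
            exact h4.rename _
      | fam u K =>
        cases h1 with
        | fam h1 =>
          cases hS with
          | skipFam hS =>
            obtain ⟨S', h3, h4⟩ := ih h2 hy hS
            exact ⟨S', .skipFam h3, h4⟩

theorem inst_add_length (N : List Obj) (x : ℕ) : inst N (x + N.length) = .var x := by
  simp [inst]

/-- Skipping the innermost `N.length - i` variables leaves the first `i`, over which the `i`-th type
(counted from `0`) is formed. -/
theorem inst_take {N : List Obj} {i : ℕ} (hi : i ≤ N.length) (x : ℕ) :
    inst N (x + (N.length - i)) = inst (N.take i) x := by
  have hrev : N.reverse = (N.drop i).reverse ++ (N.take i).reverse := by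
    rw [← List.reverse_append, List.take_append_drop]
  rw [inst, inst, hrev, List.getElem?_append_right (by simp)]
  simp only [List.length_reverse, List.length_drop, Nat.add_sub_cancel, List.length_take]
  congr 2; omega

theorem inst_getElem {N : List Obj} {i : ℕ} {Ni : Obj} (h : N[i]? = some Ni) :
    inst N (N.length - 1 - i) = Ni := by
  obtain ⟨hi, -⟩ := List.getElem?_eq_some_iff.1 h
  rw [inst, List.getElem?_reverse (by omega), show N.length - 1 - (N.length - 1 - i) = i by omega, h]
  rfl

/-- Variables that are not instantiated are mapped to variables of a corresponding type. -/
theorem CtxNF.hasObj_of_not_mem {Δ Δ' Γ : Ctx} {N : List Obj} {B : List Fam}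
    (hlen : N.length = B.length) (h : CtxNF (substCtx (inst N) Δ) Δ') {y : ℕ}
    (hy : y < objCount Δ ∨ objCount Δ + B.length ≤ y) {S : Fam}
    (hS : HasObj (Δ ++ (telescope B ++ Γ)) y S) :
    ∃ y' S', upN (objCount Δ) (inst N) y = .var y' ∧ HasObj (Δ' ++ Γ) y' S' ∧
      Conv S' (S.subst (upN (objCount Δ) (inst N))) := by
  rcases hy with hy | hy
  · obtain ⟨S', h1, h2⟩ := h.hasObj (Γ := Γ) hy hS
    exact ⟨y, S', upN_lt hy _, h1, h2⟩
  · obtain ⟨x, rfl⟩ : ∃ x, y = x + N.length + objCount Δ := ⟨y - (B.length + objCount Δ), by omega⟩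
    obtain ⟨S₁, hS₁, rfl⟩ := hS.of_append
    rw [hlen, ← objCount_telescope B] at hS₁
    obtain ⟨S₂, hS₂, rfl⟩ := hS₁.of_append
    have hvar : ∀ x, upN (objCount Δ) (inst N) (x + N.length + objCount Δ) =
        .var (x + objCount Δ) := by
      intro x; rw [upN_add, inst_add_length]; rfl
    have h1 := hS₂.append Δ'
    rw [h.objCount_eq] at h1
    refine ⟨_, _, hvar x, h1, .of_eq ?_⟩
    rw [subst_rename, subst_rename, ← subst_ren]
    congr 1; funext x
    rw [objCount_telescope, ← hlen, hvar]

/-! ### Redundancy of typing for rigidly occurring variables -/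

/-- Two spines over convertible products are traversed together. Injectivity of products makes the
domains convertible, and convertible arguments keep the codomains so. -/
theorem Spine.exists_instance {P P' : Obj → Fam → Prop} {σ : ℕ → Obj} {Ms Ms' : List Obj}
    (hMs : List.Forall₂ (fun M M' => BetaNF (M.subst σ) M') Ms Ms') {s s' : ℕ → Obj}
    {S S' A A' : Fam} (h : Spine P s S Ms A) (h' : Spine P' s' S' Ms' A')
    (hconv : Conv ((S.subst s).subst σ) (S'.subst s')) {M : Obj} (hM : M ∈ Ms) :
    ∃ M' B B', P M B ∧ P' M' B' ∧ BetaNF (M.subst σ) M' ∧ BetaNF (B.subst σ) B' := by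
  induction hMs generalizing s s' S S' with
  | nil => simp at hM
  | @cons Q Q' Ms Ms' hQ _ ih =>
    cases h with
    | @consF _ B B₁ S _ _ _ h1 h2 h3 =>
      cases h' with
      | @consF _ B' B₁' S' _ _ _ h1' h2' h3' =>
        obtain ⟨hB, hS⟩ := Conv.piF_inj hconv
        rcases List.mem_cons.1 hM with rfl | hM
        · refine ⟨Q', B₁, B₁', h2, h2', hQ, Conv.betaNF ?_ h1'.2⟩
          exact (h1.conv.symm.subst_left σ).trans (hB.trans h1'.conv)
        · refine ih h3 h3' ?_ hM
          -- Both codomains become bodies under `up` followed by one instantiation, so that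
          -- convertibility of bodies and of arguments combine.
          rw [← subst_up_scons, ← subst_up_scons S', subst_scons_subst]
          exact hS.subst (Conv.scons hQ.conv fun _ => .refl _)

/-- Induction on the rigid occurrence: the application and abstraction cases pass to a subterm typed
in both derivations, and the initial case abstracts over the pattern variables. -/
theorem Rigid.exists_longForm {Γ : Ctx} {N : List Obj} {B : List Fam}
    (hlen : N.length = B.length) {i : ℕ} {Ni : Obj} {Bi : Fam}
    (hNi : N[i]? = some Ni) (hBi : B[i]? = some Bi) {d : ℕ} {M : Obj}
    (h : Rigid B.length i d M) {Δ Δ' : Ctx} (hd : d = objCount Δ) {M' : Obj} {A A' : Fam}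
    (hΔ' : CtxNF (substCtx (inst N) Δ) Δ')
    (hM' : BetaNF (M.subst (upN (objCount Δ) (inst N))) M')
    (hA' : BetaNF (A.subst (upN (objCount Δ) (inst N))) A')
    (habs : Derivable (.obj (Δ ++ (telescope B ++ Γ)) M A))
    (hinst : Derivable (.obj (Δ' ++ Γ) M' A')) :
    ∃ Bi' Ni', BetaNF (Bi.subst (inst (N.take i))) Bi' ∧ LongForm Bi' Ni Ni' ∧
      Derivable (.obj Γ Ni' Bi') := by
  induction h generalizing Δ Δ' M' A A' with
  | @init d y P hyd hnodup hP =>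
    subst hd
    obtain ⟨hi, hBi'⟩ := List.getElem?_eq_some_iff.1 hBi
    have hB : B = B.take i ++ [Bi] ++ B.drop (i + 1) := by
      rw [← hBi']; simp
    have hctx := habs.ctx
    simp only [Assertion.context] at hctx
    obtain ⟨S, hS, hspine⟩ := habs.appsO_inv
    -- Isolates the declaration of `xᵢ`, to read off its declared type and the well-formedness of
    -- `Bᵢ` over the earlier variables.
    have hsplit : Δ ++ (telescope B ++ Γ) = (Δ ++ telescope (B.drop (i + 1))) ++
        (.obj Bi :: (telescope (B.take i) ++ Γ)) := by
      conv_lhs => rw [hB]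
      simp [telescope]
    have hctx' := Derivable.ctx_of_append (hsplit ▸ hctx)
    obtain ⟨hBity, hΓ₀⟩ := hctx'.obj_cons_inv
    have hcount : objCount (Δ ++ telescope (B.drop (i + 1))) =
        objCount Δ + (B.length - 1 - i) := by
      rw [objCount_append, objCount_telescope, List.length_drop]; omega
    have hxi := HasObj.append (HasObj.here (Γ := telescope (B.take i) ++ Γ) (A := Bi))
      (Δ ++ telescope (B.drop (i + 1)))
    rw [← hsplit, hcount, zero_add, shift_rename] at hxi
    obtain rfl := hS.unique hxi
    have hskel : Skel (famDom Γ) Bi := by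
      have := hBity.allSkel rfl
      rwa [famDom_telescope_append] at this
    have hMi : upN (objCount Δ) (inst N) (objCount Δ + (B.length - 1 - i)) =
        Ni.rename (· + objCount Δ) := by
      rw [add_comm, upN_add, ← hlen, inst_getElem hNi]
    obtain ⟨ρ', S', h1, h2, rfl⟩ := Spine.varSpine etaVarsTyped hBity
      (fun x A hx => .inl rfl) hspine.subst_rename
      (hP.imp fun y P ⟨T, hT⟩ => ⟨T, trivial, hT⟩)
    have hr := reflects_add hinst.ctx
    rw [hΔ'.objCount_eq] at hr
    refine h1.exists_longForm h2 (fun y hy => upN_lt hy _) hinst.ctx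
      (fun y hy T hT => hΔ'.hasObj hy hT) hinst hA'.conv.symm hyd hnodup
      (Derivable.ctx_of_append hΓ₀) hr
      -- Variables of `Γ` have index at least `objCount Δ` in the large context, whereas the pattern
      -- variables lie below it.
      (fun x hx => absurd (hyd _ hx) (by omega)) ?_ hskel ?_
    · intro x
      rw [← inst_take (by omega), ← upN_add]
      congr 1; omega
    · rw [appsO_subst, Exp.subst, hMi] at hM'
      exact hM'.conv
  | @app d y Ms Mk hy hMk _ ih =>
    subst hd
    obtain ⟨S, hS, hspine⟩ := habs.appsO_inv
    -- This is where rigidity matters: the head survives the substitution as a variable, possibly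
    -- with a shifted index.
    obtain ⟨y', S', hy', hS', hconv⟩ := hΔ'.hasObj_of_not_mem hlen hy hS
    rw [appsO_subst, Exp.subst, hy'] at hM'
    obtain ⟨Ms', rfl, hMs⟩ := hM'.appsO_var_inv
    obtain ⟨S'', hS'', hspine'⟩ := hinst.appsO_inv
    obtain rfl := hS''.unique hS'
    rw [List.forall₂_map_left_iff] at hMs
    obtain ⟨M', C, C', h1, h2, h3, h4⟩ := Spine.exists_instance hMs hspine hspine'
      (by rw [subst_var, subst_var]; exact hconv.symm) hMk
    exact ih rfl hΔ' h3 h4 h1 h2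
  | @abs d C M _ ih =>
    obtain ⟨A, rfl, -, habs⟩ := habs.lamO_inv
    obtain ⟨C', M', rfl, hC, hM'⟩ := BetaNF.lamO_inv hM'
    obtain ⟨C'', A', rfl, -, hA''⟩ := BetaNF.piF_inv hA'
    obtain ⟨A'', heq, -, hinst⟩ := hinst.lamO_inv
    cases heq
    exact ih (Δ := .obj C :: Δ) (Δ' := .obj C' :: Δ') (by rw [hd, objCount])
      (.cons (.obj hC) hΔ') hM' hA'' habs hinst

end CanonicalLF

theorem theorem1
    (Γ Δ Δ' : CanonicalLF.Ctx)
    (N : List CanonicalLF.Obj) (B : List CanonicalLF.Fam) (hlen : N.length = B.length)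
    (i : ℕ) (Ni : CanonicalLF.Obj) (Bi : CanonicalLF.Fam)
    (hNi : N[i]? = some Ni) (hBi : B[i]? = some Bi)
    (M M' : CanonicalLF.Obj) (A A' : CanonicalLF.Fam)
    -- `M'`, `A'`, `Δ'` are the normal forms of `M[N/x]`, `A[N/x]`, `Δ[N/x]`
    (hΔ' : CanonicalLF.CtxNF (CanonicalLF.substCtx (CanonicalLF.inst N) Δ) Δ')
    (hM' : CanonicalLF.BetaNF
      (M.subst (CanonicalLF.upN (CanonicalLF.objCount Δ) (CanonicalLF.inst N))) M')
    (hA' : CanonicalLF.BetaNF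
      (A.subst (CanonicalLF.upN (CanonicalLF.objCount Δ) (CanonicalLF.inst N))) A')
    -- `xᵢ` occurs rigidly in `M`
    (hrigid : CanonicalLF.Rigid B.length i (CanonicalLF.objCount Δ) M)
    -- `Γ, x₁ : B₁, …, xₙ : Bₙ, Δ ⊢ M : A`
    (habs : CanonicalLF.Derivable (.obj (Δ ++ (CanonicalLF.telescope B ++ Γ)) M A))
    -- `Γ, Δ[N/x] ⊢ M[N/x] : A[N/x]`
    (hinst : CanonicalLF.Derivable (.obj (Δ' ++ Γ) M' A')) :
    -- `Γ ⊢ Nᵢ : Bᵢ[N₁/x₁, …, Nᵢ₋₁/xᵢ₋₁]`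
    ∃ (Bi' : CanonicalLF.Fam) (Ni' : CanonicalLF.Obj),
      CanonicalLF.BetaNF (Bi.subst (CanonicalLF.inst (N.take i))) Bi' ∧
      CanonicalLF.LongForm Bi' Ni Ni' ∧
      CanonicalLF.Derivable (.obj Γ Ni' Bi') ∧
      (CanonicalLF.LongForm Bi' Ni Ni → CanonicalLF.Derivable (.obj Γ Ni Bi')) := by
  obtain ⟨Bi', Ni', h1, h2, h3⟩ :=
    hrigid.exists_longForm hlen hNi hBi rfl hΔ' hM' hA' habs hinst
  -- An `Nᵢ` that is its own long form equals `Ni'` by uniqueness of normal forms.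
  exact ⟨Bi', Ni', h1, h2, h3, fun h => h2.unique h ▸ h3⟩
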